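/- Let $n\ge 1$, let $\Omega\subseteq\mathbb{R}^n$ be a bounded domain with smooth boundary, and let $q\in[2,\infty)$. All functions are real valued. Let $\mathring{V}^1_{q,2}(\Omega)$ be the closure of $C_c^\infty(\Omega)$ in the space $V^1_{q,2}(\Omega)=\{u\in L^2(\Omega) : \nabla u\in L^q(\Omega)^n\}$ with norm $\|u\|_{L^2}+\|\nabla u\|_{L^q}$ ($\nabla u$ the distributional gradient), and let $\mathring{W}^{1,q}(\Omega)$ be the closure of $C_c^\infty(\Omega)$ in $W^{1,q}(\Omega)$ with norm $\|u\|_{L^q}+\|\nabla u\|_{L^q}$. Let $\mathcal{E}:L^2(\Omega)\to[0,\infty]$ be given by $\mathcal{E}(u)=\frac1q\int_\Omega|\nabla u|^q$ if $u\in\mathring{V}^1_{q,2}(\Omega)$ and $\mathcal{E}(u)=\infty$ otherwise. The negative Dirichlet $q$-Laplace operator $-\Delta_q$ on $L^2(\Omega)$ is the subgradient \[ -\Delta_q=\partial\mathcal{E}=\{(u,f)\in L^2(\Omega)\times L^2(\Omega) : \mathcal{E}(u)<\infty \text{ and } \mathcal{E}(v)-\mathcal{E}(u)\ge\langle f,v-u\rangle_{L^2}\text{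 for all }v\in L^2(\Omega)\}, \] and $|\Delta_q u|=\inf\{\|f\|_{L^2} : (u,f)\in-\Delta_q\}$, with $\inf\emptyset=\infty$. For $\eta\in(0,1)$ and $s\in(1,\infty)$ let $\mathrm{E}_{\eta,s}=L^s(0,\infty;t^{s(1-\eta)-1}\,dt)$. For $u\in L^2(\Omega)$ and $t>0$ put \[ K(u,t)=\inf_{v\in L^2(\Omega)}\bigl(\|u-v\|_{L^2}+t\,|\Delta_q v|\bigr), \] and for $\tau>0$ let $\mathcal{N}^\tau_{\mathrm{E}_{\theta,p}}(u)\in[0,\infty]$ be the norm in $\mathrm{E}_{\theta,p}$ of $t\mapsto\frac{K(u,t)}{t}\chi_{(0,\tau)}(t)$ ($=\infty$ if this function is not in $\mathrm{E}_{\theta,p}$). Then, for every $\theta\in(0,\frac12)$, every $p\in(1,\infty)$ and every $\tau>0$, \[ \{u\in L^2(\Omega) : \mathcal{N}^\tau_{\mathrm{E}_{\theta,p}}(u)<\infty\}=(L^2(\Omega),\mathring{W}^{1,q}(\Omega))_{\alpha,r},\qquad \alpha=\frac{q\theta}{1+\theta(q-2)},\quad r=p\,(1+\theta(q-2)). \]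 Here $(X_0,X_1)_{\alpha,r}$ is the classical real interpolation space of all $x\in X_0+X_1$ such that $t\mapsto\frac1t\inf\{\|x_0\|_{X_0}+t\|x_1\|_{X_1} : x=x_0+x_1,\ x_i\in X_i\}$ belongs to $\mathrm{E}_{\alpha,r}$. -/

import Mathlib

open MeasureTheory Set Topology
open scoped ENNReal ContDiff InnerProductSpace

noncomputable section

namespace QLap

/-! ### Interpolation of functions by the K-method -/

section Interpolation

variable {X : Type*}

/-- The effective domain of a function with values in `[0, ∞]`. -/
def effDomain (N : X → ℝ≥0∞) : Set X := {x | N x < ⊤}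

/-- The measure `t ^ (p (1 - θ) - 1) dt` on `(0, ∞)`. -/
def weightMeasure (θ p : ℝ) : Measure ℝ :=
  (volume.restrict (Ioi 0)).withDensity fun t => ENNReal.ofReal (t ^ (p * (1 - θ) - 1))

/-- The (extended) norm of the weighted space `E_{θ,p} = L^p (0, ∞; t ^ (p (1 - θ) - 1) dt)`, for
functions with values in `[0, ∞]`. It is only applied to functions that are monotone in `t`,
divided by `t` and possibly cut off, so that measurability is automatic. -/
def weightedNorm (θ p : ℝ) (f : ℝ → ℝ≥0∞) : ℝ≥0∞ :=
  eLpNorm f (ENNReal.ofReal p) (weightMeasure θ p)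

/-- The `K`-function `K(x, t) = inf_v (N₀ (x - v) + t N₁ v)` of a couple of functions `(N₀, N₁)`;
it is used for `t > 0` only. -/
def kFun [AddGroup X] (N₀ N₁ : X → ℝ≥0∞) (x : X) (t : ℝ) : ℝ≥0∞ :=
  ⨅ v : X, N₀ (x - v) + ENNReal.ofReal t * N₁ v

/-- The finite interpolation function (K-method) of the couple `(N₀, N₁)` associated with
the space `E_{θ,p}`: the norm in `E_{θ,p}` of `t ↦ (K(x, t) / t) χ_{(0,τ)}(t)`. -/
def interpFun [AddGroup X] (N₀ N₁ : X → ℝ≥0∞) (θ p τ : ℝ) (x : X) : ℝ≥0∞ :=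
  weightedNorm θ p ((Ioo 0 τ).indicator fun t => kFun N₀ N₁ x t / ENNReal.ofReal t)

/-- The classical `K`-functional `inf {‖x₀‖_{X₀} + t ‖x₁‖_{X₁} | x = x₀ + x₁}` of a couple of
normed spaces `X₀, X₁ ⊆ X`. The spaces are given by their norms, extended by `∞` outside. -/
def linearK [Add X] (norm₀ norm₁ : X → ℝ≥0∞) (x : X) (t : ℝ) : ℝ≥0∞ :=
  ⨅ (x₀ : X) (x₁ : X) (_ : x = x₀ + x₁), norm₀ x₀ + ENNReal.ofReal t * norm₁ x₁

/-- The classical real interpolation space `(X₀, X₁)_{θ,p}`, with `X₀, X₁ ⊆ X` given by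
their norms, extended by `∞` outside. -/
def realInterp [Add X] (norm₀ norm₁ : X → ℝ≥0∞) (θ p : ℝ) : Set X :=
  {x | weightedNorm θ p (fun t => linearK norm₀ norm₁ x t / ENNReal.ofReal t) < ⊤}

end Interpolation

/-! ### Operators on a space and subgradients -/

section Operators

/-- The set norm `|A x| = inf {‖f‖ | (x, f) ∈ A}` of a relation `A ⊆ X × X`
(`∞` outside the domain of `A`). -/
def setNorm {X : Type*} [NormedAddCommGroup X] (A : Set (X × X)) (x : X) : ℝ≥0∞ :=
  ⨅ (f : X) (_ : (x, f) ∈ A), ‖f‖ₑ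

/-- The subgradient of a function `F : H → [0, ∞]` on a Hilbert space. -/
def subgradient {H : Type*} [NormedAddCommGroup H] [InnerProductSpace ℝ H] (F : H → ℝ≥0∞) :
    Set (H × H) :=
  {z | z.1 ∈ effDomain F ∧
    ∀ v : H, ((⟪z.2, v - z.1⟫_ℝ : ℝ) : EReal) + (F z.1 : EReal) ≤ (F v : EReal)}

end Operators

/-! ### Domains, weak gradients and Sobolev spaces -/

section Sobolev

variable {n : ℕ}

/-- A bounded smooth domain of `ℝⁿ`: a bounded, open, connected, non-empty set which near every
boundary point is the sublevel set `{φ < 0}` of a smooth function with non-zero differential. -/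
structure IsBoundedSmoothDomain (Ω : Set (EuclideanSpace ℝ (Fin n))) : Prop where
  isOpen : IsOpen Ω
  isConnected : IsConnected Ω
  isBounded : Bornology.IsBounded Ω
  smooth_boundary : ∀ x ∈ frontier Ω, ∃ U : Set (EuclideanSpace ℝ (Fin n)), IsOpen U ∧ x ∈ U ∧
    ∃ φ : EuclideanSpace ℝ (Fin n) → ℝ, ContDiffOn ℝ ∞ φ U ∧ fderiv ℝ φ x ≠ 0 ∧
      Ω ∩ U = {y ∈ U | φ y < 0}

/-- The real Hilbert space `L²(Ω)`. -/
abbrev L2 (Ω : Set (EuclideanSpace ℝ (Fin n))) : Type :=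
  Lp ℝ 2 (volume.restrict Ω)

/-- `φ` belongs to `C_c^∞(Ω)`. -/
structure IsTestFunction (Ω : Set (EuclideanSpace ℝ (Fin n)))
    (φ : EuclideanSpace ℝ (Fin n) → ℝ) : Prop where
  contDiff : ContDiff ℝ ∞ φ
  hasCompactSupport : HasCompactSupport φ
  tsupport_subset : tsupport φ ⊆ Ω

/-- `g` is a distributional gradient on `Ω` of the function `u`. -/
structure HasWeakGradient (Ω : Set (EuclideanSpace ℝ (Fin n)))
    (u : EuclideanSpace ℝ (Fin n) → ℝ)
    (g : EuclideanSpace ℝ (Fin n) → EuclideanSpace ℝ (Fin n)) : Prop where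
  locallyIntegrableOn_fun : LocallyIntegrableOn u Ω
  locallyIntegrableOn_grad : LocallyIntegrableOn g Ω
  integral_eq : ∀ φ : EuclideanSpace ℝ (Fin n) → ℝ, IsTestFunction Ω φ →
    ∫ x in Ω, u x • gradient φ x = -∫ x in Ω, φ x • g x

open Classical in
/-- The distributional gradient on `Ω` of `u` (unique up to null sets of `Ω`), and `0` if `u` has no
locally integrable distributional gradient. -/
def weakGradient (Ω : Set (EuclideanSpace ℝ (Fin n))) (u : EuclideanSpace ℝ (Fin n) → ℝ) :
    EuclideanSpace ℝ (Fin n) → EuclideanSpace ℝ (Fin n) :=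
  if h : ∃ g, HasWeakGradient Ω u g then h.choose else 0

open Classical in
/-- For `u ∈ L²(Ω)`, the norm `‖u‖_{L^s(Ω)} + ‖∇u‖_{L^q(Ω)ⁿ}`, which is `∞` if `u` is not in
`L^s(Ω)` or has no distributional gradient in `L^q(Ω)ⁿ`. -/
def sobolevNorm (Ω : Set (EuclideanSpace ℝ (Fin n))) (s q : ℝ) (u : L2 Ω) : ℝ≥0∞ :=
  if ∃ g, HasWeakGradient Ω u g then
    eLpNorm u (ENNReal.ofReal s) (volume.restrict Ω) +
      eLpNorm (weakGradient Ω u) (ENNReal.ofReal q) (volume.restrict Ω)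
  else ⊤

/-- The closure of the test functions `C_c^∞(Ω)` in the space
`{u ∈ L²(Ω) | u ∈ L^s(Ω), ∇u ∈ L^q(Ω)ⁿ}`, with respect to the norm of that space. -/
def sobolevZero (Ω : Set (EuclideanSpace ℝ (Fin n))) (s q : ℝ) : Set (L2 Ω) :=
  {u | sobolevNorm Ω s q u < ⊤ ∧ ∀ ε : ℝ≥0∞, 0 < ε → ∃ v : L2 Ω,
    (∃ φ, IsTestFunction Ω φ ∧ v =ᵐ[volume.restrict Ω] φ) ∧ sobolevNorm Ω s q (u - v) < ε}

/-- The closure of `C_c^∞(Ω)` in `V¹_{q,2}(Ω) = {u ∈ L²(Ω) | ∇u ∈ L^q(Ω)ⁿ}`. -/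
def V0 (Ω : Set (EuclideanSpace ℝ (Fin n))) (q : ℝ) : Set (L2 Ω) := sobolevZero Ω 2 q

/-- The closure of `C_c^∞(Ω)` in `W^{1,q}(Ω)`, as a subset of `L²(Ω)` (`Ω` bounded, `q ≥ 2`). -/
def W0 (Ω : Set (EuclideanSpace ℝ (Fin n))) (q : ℝ) : Set (L2 Ω) := sobolevZero Ω q q

open Classical in
/-- The norm of `W^{1,q}(Ω)` on `W0 Ω q`, extended by `∞` to `L²(Ω)`. -/
def W0norm (Ω : Set (EuclideanSpace ℝ (Fin n))) (q : ℝ) (u : L2 Ω) : ℝ≥0∞ :=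
  if u ∈ W0 Ω q then sobolevNorm Ω q q u else ⊤

open Classical in
/-- The energy of the negative Dirichlet `q`-Laplace operator: `(1/q) ∫_Ω |∇u|^q` on `V0 Ω q`,
and `∞` elsewhere on `L²(Ω)`. -/
def energy (Ω : Set (EuclideanSpace ℝ (Fin n))) (q : ℝ) (u : L2 Ω) : ℝ≥0∞ :=
  if u ∈ V0 Ω q then ENNReal.ofReal (1 / q) * ∫⁻ x in Ω, ‖weakGradient Ω u x‖ₑ ^ q else ⊤

/-- The negative Dirichlet `q`-Laplace operator `-Δ_q` on `L²(Ω)`. -/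
def negLaplacian (Ω : Set (EuclideanSpace ℝ (Fin n))) (q : ℝ) : Set (L2 Ω × L2 Ω) :=
  subgradient (energy Ω q)

end Sobolev

end QLap

end

namespace QLap

/-! ### Weighted norms of monotone functions as sums over lacunary sequences -/

section Weights

/-! Everything is read off from `zeroGraph`, the closure V in L² × L^q of the graph of the gradient
on test functions. By Poincaré's inequality (`IsTestFunction.eLpNorm_le`) both Sobolev closures are
the projection of V, the energy is ‖G‖^q / q for (u, G) ∈ V, and the W^{1,q} norm is equivalent to
‖G‖. The rest is abstract: a Hilbert space, a closed linear graph V and Clarkson's inequality.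

The nonlinear and the linear K-function are compared through the Moreau envelope m(l) of the energy.
If κ is the linear K-function at s and l = κ^(2-q) s^q, the two terms of the envelope balance and l
m(l) is comparable to κ² (`IsPowerEnergy.mul_moreau_le`, `IsPowerEnergy.sq_le_mul_moreau`). This
substitution also produces the exponents: l^(-θp) κ^p = s^(-αr) κ^r.

The proximal point v of u lies in the domain of the subgradient, with element (u - v)/l, so the
nonlinear K-function at l is at most 2√(2 l m(l)) (`IsPowerEnergy.kFun_subgradient_le`). In the
other direction, the subgradient inequality bounds only the growth of m between comparable
parameters, by K(l)²/l (`IsPowerEnergy.moreau_le_add`). For l^(1/2-θ) √m(l) along a lacunary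
sequence this is a recursion that contracts because θ < 1/2, and a discrete Hardy inequality
(`summable_rpow_of_le_mul_add`) sums it.

Both norms become sums along lacunary sequences: s_k = 2^(-k) on the linear side and the
corresponding l_k, whose ratios lie between 4 and 2^q, on the nonlinear side. Since both K-functions
are bounded by ‖u‖, the cut-off τ plays no role. -/

theorem weightedNorm_lt_top_iff {θ p : ℝ} (hp : 0 < p) (f : ℝ → ℝ≥0∞) :
    weightedNorm θ p f < ⊤ ↔
      ∫⁻ t in Ioi (0 : ℝ), ENNReal.ofReal (t ^ (p * (1 - θ) - 1)) * f t ^ p < ⊤ := by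
  have h0 : ENNReal.ofReal p ≠ 0 := by simpa using hp
  rw [weightedNorm, eLpNorm_lt_top_iff_lintegral_rpow_enorm_lt_top h0 ENNReal.ofReal_ne_top,
    weightMeasure, lintegral_withDensity_eq_lintegral_mul_non_measurable]
  · simp [ENNReal.toReal_ofReal hp.le]
  · exact (measurable_id.pow_const _).ennreal_ofReal
  · exact Filter.Eventually.of_forall fun x => ENNReal.ofReal_lt_top

theorem ofReal_rpow_mul_div_rpow {θ p t : ℝ} (hp : 0 < p) (ht : 0 < t) (x : ℝ≥0∞) :
    ENNReal.ofReal (t ^ (p * (1 - θ) - 1)) * (x / ENNReal.ofReal t) ^ p =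
      ENNReal.ofReal (t ^ (-(θ * p) - 1)) * x ^ p := by
  rw [ENNReal.div_rpow_of_nonneg _ _ hp.le, ENNReal.ofReal_rpow_of_pos ht, div_eq_mul_inv,
    ← ENNReal.ofReal_inv_of_pos (by positivity), mul_comm (x ^ p), ← mul_assoc,
    ← ENNReal.ofReal_mul (by positivity), ← Real.rpow_neg ht.le, ← Real.rpow_add ht]
  congr 3
  ring

/-- The weighted integral of a bounded function is finite away from the origin. -/
theorem lintegral_Ioi_lt_top_of_Ioo {a p τ : ℝ} (ha : 0 < a) (hp : 0 < p) (hτ : 0 < τ)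
    {κ : ℝ → ℝ≥0∞} {N : ℝ≥0∞} (hN : N ≠ ⊤) (hκ : ∀ t, 0 < t → κ t ≤ N)
    (h : ∫⁻ t in Ioo 0 τ, ENNReal.ofReal (t ^ (-a - 1)) * κ t ^ p < ⊤) :
    ∫⁻ t in Ioi 0, ENNReal.ofReal (t ^ (-a - 1)) * κ t ^ p < ⊤ := by
  have hsub : Ioi (0 : ℝ) ⊆ Ioo 0 τ ∪ Ioi (τ / 2) := by
    intro t ht
    by_cases h' : t < τ
    · exact Or.inl ⟨ht, h'⟩
    · exact Or.inr (by simp only [mem_Ioi]; linarith)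
  refine (lintegral_mono_set hsub).trans_lt ((lintegral_union_le _ _ _).trans_lt ?_)
  refine ENNReal.add_lt_top.2 ⟨h, ?_⟩
  have hint := integrableOn_Ioi_rpow_of_lt (a := -a - 1) (by linarith) (c := τ / 2) (by linarith)
  calc ∫⁻ t in Ioi (τ / 2), ENNReal.ofReal (t ^ (-a - 1)) * κ t ^ p
      ≤ ∫⁻ t in Ioi (τ / 2), ENNReal.ofReal (t ^ (-a - 1)) * N ^ p := by
        refine setLIntegral_mono' measurableSet_Ioi fun t ht => ?_
        have : 0 < t := lt_trans (by positivity) ht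
        gcongr
        exact hκ t this
    _ = (∫⁻ t in Ioi (τ / 2), ENNReal.ofReal (t ^ (-a - 1))) * N ^ p :=
        lintegral_mul_const' _ _ (ENNReal.rpow_ne_top_of_nonneg hp.le hN)
    _ < ⊤ := ENNReal.mul_lt_top hint.lintegral_lt_top
        (ENNReal.rpow_lt_top_of_nonneg hp.le hN)

/-- Lacunarity makes the intervals [l k, 2 l k) disjoint. On each of them κ is at least κ(l k) and
the weight is at least (2 l k)^(-a-1), so each carries a fixed multiple of the corresponding term.
-/
theorem summable_of_lintegral_lt_top {a p : ℝ} (hp : 0 < p) {κ : ℝ → ℝ≥0∞}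
    (hκ : MonotoneOn κ (Ioi 0)) {l : ℕ → ℝ} (hl : ∀ k, 0 < l k) (hl2 : ∀ k, 2 * l (k + 1) ≤ l k)
    (ha : 0 < a) (h : ∫⁻ t in Ioi 0, ENNReal.ofReal (t ^ (-a - 1)) * κ t ^ p < ⊤) :
    Summable fun k => l k ^ (-a) * (κ (l k)).toReal ^ p := by
  have hanti : Antitone l := antitone_nat_of_succ_le fun k => by linarith [hl2 k, hl (k + 1)]
  have hdisj : Pairwise (Function.onFun Disjoint fun k => Ico (l k) (2 * l k)) := by
    refine (pairwise_disjoint_on _).2 fun i j hij => ?_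
    refine Set.disjoint_left.2 fun t ht ht' => ?_
    have h1 := hanti (Nat.succ_le_of_lt hij)
    have h2 := hl2 i
    simp only [mem_Ico, Nat.succ_eq_add_one] at ht ht' h1
    linarith
  have hsum : ∑' k, ∫⁻ t in Ico (l k) (2 * l k), ENNReal.ofReal (t ^ (-a - 1)) * κ t ^ p < ⊤ := by
    rw [← lintegral_iUnion (fun k => measurableSet_Ico) hdisj]
    refine (lintegral_mono_set ?_).trans_lt h
    exact iUnion_subset fun k t ht => (hl k).trans_le ht.1
  have hle : ∀ k, ENNReal.ofReal (2 ^ (-a - 1)) * (ENNReal.ofReal (l k ^ (-a)) * κ (l k) ^ p) ≤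
      ∫⁻ t in Ico (l k) (2 * l k), ENNReal.ofReal (t ^ (-a - 1)) * κ t ^ p := by
    intro k
    have hk := hl k
    calc ENNReal.ofReal (2 ^ (-a - 1)) * (ENNReal.ofReal (l k ^ (-a)) * κ (l k) ^ p)
        = ∫⁻ t in Ico (l k) (2 * l k), ENNReal.ofReal ((2 * l k) ^ (-a - 1)) * κ (l k) ^ p := by
          rw [setLIntegral_const, Real.volume_Ico, mul_right_comm,
            ← ENNReal.ofReal_mul (by positivity), ← mul_assoc, ← ENNReal.ofReal_mul (by positivity)]
          congr 2
          rw [Real.mul_rpow (by norm_num) hk.le, show 2 * l k - l k = l k by ring, mul_assoc]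
          congr 1
          rw [← Real.rpow_add_one hk.ne']
          ring_nf
      _ ≤ _ := by
          refine setLIntegral_mono' measurableSet_Ico fun t ht => ?_
          have htp : 0 < t := hk.trans_le ht.1
          gcongr ?_ * ?_
          · exact ENNReal.ofReal_le_ofReal
              (Real.rpow_le_rpow_of_nonpos htp ht.2.le (by linarith))
          · exact ENNReal.rpow_le_rpow (hκ hk htp ht.1) hp.le
  have hfin : ∑' k, ENNReal.ofReal (l k ^ (-a)) * κ (l k) ^ p ≠ ⊤ := by
    have := (ENNReal.tsum_le_tsum hle).trans_lt hsum
    rw [ENNReal.tsum_mul_left] at this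
    intro htop
    rw [htop, ENNReal.mul_top] at this
    · exact lt_irrefl _ this
    · simp only [ne_eq, ENNReal.ofReal_eq_zero, not_le]
      positivity
  refine (ENNReal.summable_toReal hfin).congr fun k => ?_
  have := hl k
  rw [ENNReal.toReal_mul, ENNReal.toReal_ofReal (by positivity), ENNReal.toReal_rpow]

theorem tendsto_zero_of_two_mul_succ_le {l : ℕ → ℝ} (hl : ∀ k, 0 < l k)
    (hl2 : ∀ k, 2 * l (k + 1) ≤ l k) : Filter.Tendsto l Filter.atTop (𝓝 0) := by
  have hle : ∀ k, l k ≤ l 0 * (1 / 2) ^ k := by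
    intro k
    induction k with
    | zero => simp
    | succ k ih => rw [pow_succ]; linarith [hl2 k]
  refine squeeze_zero (fun k => (hl k).le) hle ?_
  have := (tendsto_pow_atTop_nhds_zero_of_lt_one (r := (1 / 2 : ℝ)) (by norm_num)
    (by norm_num)).const_mul (l 0)
  simpa using this

/-- The intervals [l (k+1), l k) cover (0, l 0) because l tends to 0. The ratio bound B keeps the
weight comparable to its value at l k, and beyond l 0 the boundedness of κ suffices. -/
theorem lintegral_lt_top_of_summable {a p B : ℝ} (ha : 0 < a) (hp : 0 < p) {κ : ℝ → ℝ≥0∞}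
    (hκ : MonotoneOn κ (Ioi 0)) {N : ℝ≥0∞} (hN : N ≠ ⊤) (hκN : ∀ t, 0 < t → κ t ≤ N)
    {l : ℕ → ℝ} (hl : ∀ k, 0 < l k)
    (hl2 : ∀ k, 2 * l (k + 1) ≤ l k) (hlB : ∀ k, l k ≤ B * l (k + 1))
    (h : Summable fun k => l k ^ (-a) * (κ (l k)).toReal ^ p) :
    ∫⁻ t in Ioi 0, ENNReal.ofReal (t ^ (-a - 1)) * κ t ^ p < ⊤ := by
  refine lintegral_Ioi_lt_top_of_Ioo ha hp (hl 0) hN hκN ?_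
  have hB : 0 < B := by
    by_contra hB
    nlinarith [hlB 0, hl 0, hl 1]
  have hsub : Ioo 0 (l 0) ⊆ ⋃ k, Ico (l (k + 1)) (l k) := by
    rintro t ⟨ht0, ht⟩
    have hex : ∃ k, l k ≤ t :=
      ((tendsto_zero_of_two_mul_succ_le hl hl2).eventually (gt_mem_nhds ht0)).exists.imp
        fun k hk => hk.le
    classical
    have h1 := Nat.find_spec hex
    rcases hk : Nat.find hex with _ | k
    · rw [hk] at h1
      linarith
    · rw [hk] at h1
      have h2 := Nat.find_min hex (m := k) (by omega)
      exact mem_iUnion.2 ⟨k, h1, not_le.1 h2⟩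
  refine (lintegral_mono_set hsub).trans_lt ((lintegral_iUnion_le _ _).trans_lt ?_)
  have hle : ∀ k, ∫⁻ t in Ico (l (k + 1)) (l k), ENNReal.ofReal (t ^ (-a - 1)) * κ t ^ p ≤
      ENNReal.ofReal (B ^ (a + 1) * (l k ^ (-a) * (κ (l k)).toReal ^ p)) := by
    intro k
    have hk := hl k
    have hk1 := hl (k + 1)
    calc ∫⁻ t in Ico (l (k + 1)) (l k), ENNReal.ofReal (t ^ (-a - 1)) * κ t ^ p
        ≤ ∫⁻ t in Ico (l (k + 1)) (l k), ENNReal.ofReal (B ^ (a + 1) * l k ^ (-a - 1)) *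
            κ (l k) ^ p := by
          refine setLIntegral_mono' measurableSet_Ico fun t ht => ?_
          have htp : 0 < t := hk1.trans_le ht.1
          gcongr ?_ * ?_
          · refine ENNReal.ofReal_le_ofReal ?_
            calc t ^ (-a - 1) ≤ (l k / B) ^ (-a - 1) := by
                  refine Real.rpow_le_rpow_of_nonpos (by positivity) ?_ (by linarith)
                  rw [div_le_iff₀ hB]
                  nlinarith [hlB k, ht.1]
              _ = B ^ (a + 1) * l k ^ (-a - 1) := by
                  rw [Real.div_rpow hk.le hB.le, div_eq_mul_inv, ← Real.rpow_neg hB.le, mul_comm]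
                  ring_nf
          · exact ENNReal.rpow_le_rpow (hκ htp hk ht.2.le) hp.le
      _ ≤ ENNReal.ofReal (B ^ (a + 1) * l k ^ (-a - 1)) * κ (l k) ^ p * ENNReal.ofReal (l k) := by
          rw [setLIntegral_const, Real.volume_Ico]
          gcongr
          linarith
      _ = _ := by
          rw [mul_right_comm, ← ENNReal.ofReal_mul (by positivity), ← mul_assoc,
            ENNReal.ofReal_mul (p := B ^ (a + 1) * l k ^ (-a)) (by positivity),
            ENNReal.toReal_rpow, ENNReal.ofReal_toReal]
          · congr 2
            rw [mul_assoc, ← Real.rpow_add_one hk.ne']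
            ring_nf
          · exact ENNReal.rpow_ne_top_of_nonneg hp.le (ne_top_of_le_ne_top hN (hκN _ hk))
  refine (ENNReal.tsum_le_tsum hle).trans_lt ?_
  exact lt_top_iff_ne_top.2 (h.mul_left _).tsum_ofReal_ne_top

/-- A discrete Hardy inequality. -/
theorem summable_rpow_of_le_mul_add {p ρ C : ℝ} (hp : 1 ≤ p) (hρ : 0 < ρ) (hρ1 : ρ < 1)
    (hC : 0 ≤ C) {c g : ℕ → ℝ} (hc : ∀ k, 0 ≤ c k) (hg : ∀ k, 0 ≤ g k)
    (h : ∀ k, c (k + 1) ≤ ρ * (c k + C * g k)) (hs : Summable fun k => g k ^ p) :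
    Summable fun k => c k ^ p := by
  have h1 : 0 < 1 - ρ := by linarith
  set D := (1 - ρ) * (ρ * C / (1 - ρ)) ^ p with hD
  have hD0 : 0 ≤ D := by positivity
  -- Convexity of the p-th power with weights ρ and 1 - ρ keeps the factor ρ < 1 in front of c k ^
  -- p; all other constants go into D.
  have hstep : ∀ k, c (k + 1) ^ p ≤ ρ * c k ^ p + D * g k ^ p := by
    intro k
    have hgk := hg k
    have hck := hc k
    have := (convexOn_rpow hp).2 (x := c k) (y := ρ * C / (1 - ρ) * g k) hck
      (by simp only [mem_Ici]; positivity) hρ.le h1.le (by ring)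
    simp only [smul_eq_mul] at this
    calc c (k + 1) ^ p ≤ (ρ * c k + (1 - ρ) * (ρ * C / (1 - ρ) * g k)) ^ p := by
          refine Real.rpow_le_rpow (hc _) ((h k).trans_eq ?_) (by linarith)
          field_simp
      _ ≤ _ := this
      _ = _ := by rw [Real.mul_rpow (by positivity) hgk, hD]; ring
  have hcp : ∀ k, 0 ≤ c k ^ p := fun k => Real.rpow_nonneg (hc k) p
  refine summable_of_sum_range_le hcp (c := (c 0 ^ p + D * ∑' k, g k ^ p) / (1 - ρ)) fun N => ?_
  rw [le_div_iff₀ h1]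
  -- Summing the recursion bounds a partial sum by ρ times itself plus a constant, and the multiple
  -- by ρ is absorbed on the left.
  have h2 : ∑ k ∈ Finset.range (N + 1), c k ^ p ≤
      c 0 ^ p + (ρ * ∑ k ∈ Finset.range N, c k ^ p + D * ∑' k, g k ^ p) := by
    rw [Finset.sum_range_succ', add_comm]
    gcongr
    calc ∑ k ∈ Finset.range N, c (k + 1) ^ p
        ≤ ∑ k ∈ Finset.range N, (ρ * c k ^ p + D * g k ^ p) :=
          Finset.sum_le_sum fun k _ => hstep k
      _ = ρ * ∑ k ∈ Finset.range N, c k ^ p + D * ∑ k ∈ Finset.range N, g k ^ p := by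
          rw [Finset.sum_add_distrib, Finset.mul_sum, Finset.mul_sum]
      _ ≤ _ := by
          gcongr
          exact hs.sum_le_tsum _ fun k _ => Real.rpow_nonneg (hg k) p
  rw [Finset.sum_range_succ] at h2
  linarith [hcp N]

end Weights

/-! ### Powers of norms on uniformly convex graphs -/

section PowerEnergy

variable {H Y : Type*} [NormedAddCommGroup H] [InnerProductSpace ℝ H]
  [NormedAddCommGroup Y] [NormedSpace ℝ Y]

theorem setNorm_le {X : Type*} [NormedAddCommGroup X] {A : Set (X × X)} {x f : X}
    (h : (x, f) ∈ A) : setNorm A x ≤ ‖f‖ₑ :=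
  iInf₂_le (f := fun (f : X) (_ : (x, f) ∈ A) => ‖f‖ₑ) f h

/-- `F` is the function `u ↦ ‖G‖ ^ q / q` on the domain of the closed linear relation `V ∋ (u, G)`,
and `∞` elsewhere, where the norm of `G` satisfies Clarkson's inequality. -/
structure IsPowerEnergy (q : ℝ) (V : Submodule ℝ (H × Y)) (F : H → ℝ≥0∞) : Prop where
  two_le : 2 ≤ q
  isClosed : IsClosed (V : Set (H × Y))
  clarkson : ∀ a b : Y, ‖(1 / 2 : ℝ) • (a + b)‖ ^ q + ‖(1 / 2 : ℝ) • (a - b)‖ ^ q ≤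
    (‖a‖ ^ q + ‖b‖ ^ q) / 2
  apply_eq : ∀ z ∈ V, F z.1 = ENNReal.ofReal (‖z.2‖ ^ q / q)
  exists_of_lt_top : ∀ u, F u < ⊤ → ∃ G, (u, G) ∈ V

/-- The functional whose infimum is the Moreau envelope of a power energy. -/
noncomputable def proxFun (q : ℝ) (u : H) (l : ℝ) (z : H × Y) : ℝ :=
  ‖z.2‖ ^ q / q + ‖u - z.1‖ ^ 2 / (2 * l)

/-- The Moreau envelope of a power energy. -/
noncomputable def moreau (q : ℝ) (V : Submodule ℝ (H × Y)) (u : H) (l : ℝ) : ℝ :=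
  ⨅ z : V, proxFun q u l z.1

namespace IsPowerEnergy

variable {q : ℝ} {V : Submodule ℝ (H × Y)} {F : H → ℝ≥0∞}

theorem proxFun_nonneg (h : IsPowerEnergy q V F) (u : H) {l : ℝ} (hl : 0 < l) (z : H × Y) :
    0 ≤ proxFun q u l z := by
  have := h.two_le
  unfold proxFun
  positivity

theorem moreau_le (h : IsPowerEnergy q V F) (u : H) {l : ℝ} (hl : 0 < l) {z : H × Y} (hz : z ∈ V) :
    moreau q V u l ≤ proxFun q u l z :=
  ciInf_le ⟨0, by rintro _ ⟨w, rfl⟩; exact h.proxFun_nonneg u hl w⟩ (⟨z, hz⟩ : V)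

theorem le_moreau {u : H} {l c : ℝ}
    (hc : ∀ z ∈ V, c ≤ proxFun q u l z) : c ≤ moreau q V u l :=
  le_ciInf fun z => hc z.1 z.2

theorem moreau_nonneg (h : IsPowerEnergy q V F) (u : H) {l : ℝ} (hl : 0 < l) :
    0 ≤ moreau q V u l :=
  le_moreau fun z _ => h.proxFun_nonneg u hl z

/-- Uniform convexity: Clarkson's inequality for the energy term, the parallelogram law for the
quadratic term. -/
theorem proxFun_midpoint_le (h : IsPowerEnergy q V F) (u : H) (l : ℝ)
    (z w : H × Y) :
    proxFun q u l ((1 / 2 : ℝ) • (z + w)) + (‖(1 / 2 : ℝ) • (z.2 - w.2)‖ ^ q / q +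
      ‖(1 / 2 : ℝ) • (z.1 - w.1)‖ ^ 2 / (2 * l)) ≤ (proxFun q u l z + proxFun q u l w) / 2 := by
  have hq := h.two_le
  have h1 := h.clarkson z.2 w.2
  have h2 := parallelogram_law_with_norm ℝ (u - z.1) (u - w.1)
  have e1 : ‖u - (1 / 2 : ℝ) • (z.1 + w.1)‖ = 1 / 2 * ‖(u - z.1) + (u - w.1)‖ := by
    rw [← norm_smul_of_nonneg (by norm_num)]
    congr 1
    module
  have e2 : ‖(1 / 2 : ℝ) • (z.1 - w.1)‖ = 1 / 2 * ‖(u - z.1) - (u - w.1)‖ := by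
    rw [norm_smul_of_nonneg (by norm_num), ← norm_neg]
    congr 2
    abel
  have h3 : ‖u - (1 / 2 : ℝ) • (z.1 + w.1)‖ ^ 2 + ‖(1 / 2 : ℝ) • (z.1 - w.1)‖ ^ 2 =
      (‖u - z.1‖ ^ 2 + ‖u - w.1‖ ^ 2) / 2 := by
    rw [e1, e2]
    linarith
  simp only [proxFun, Prod.smul_fst, Prod.smul_snd, Prod.fst_add, Prod.snd_add]
  calc _ = (‖(1 / 2 : ℝ) • (z.2 + w.2)‖ ^ q + ‖(1 / 2 : ℝ) • (z.2 - w.2)‖ ^ q) / q +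
        (‖u - (1 / 2 : ℝ) • (z.1 + w.1)‖ ^ 2 + ‖(1 / 2 : ℝ) • (z.1 - w.1)‖ ^ 2) / (2 * l) := by
        ring
    _ ≤ (‖z.2‖ ^ q + ‖w.2‖ ^ q) / 2 / q + (‖u - z.1‖ ^ 2 + ‖u - w.1‖ ^ 2) / 2 / (2 * l) := by
        rw [h3]
        gcongr
    _ = _ := by ring

/-- By uniform convexity a minimizing sequence is Cauchy in H × Y, hence converges strongly;
closedness of V and continuity of the functional finish the argument without weak topologies. -/
theorem exists_forall_proxFun_le [CompleteSpace H] [CompleteSpace Y] (h : IsPowerEnergy q V F)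
    (u : H) {l : ℝ} (hl : 0 < l) :
    ∃ z ∈ V, ∀ w ∈ V, proxFun q u l z ≤ proxFun q u l w := by
  have hq := h.two_le
  set m := moreau q V u l
  have hex : ∀ k : ℕ, ∃ z ∈ V, proxFun q u l z < m + 1 / ((k : ℝ) + 1) := fun k => by
    obtain ⟨z, hz⟩ := exists_lt_of_ciInf_lt (lt_add_of_pos_right m (Nat.one_div_pos_of_nat (α := ℝ)
      (n := k)) : (⨅ z : V, proxFun q u l z.1) < _)
    exact ⟨z.1, z.2, hz⟩
  choose x hxV hx using hex
  have htend : Filter.Tendsto (fun k : ℕ => 1 / ((k : ℝ) + 1)) Filter.atTop (𝓝 0) :=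
    tendsto_one_div_add_atTop_nhds_zero_nat
  have hcau : CauchySeq x := by
    refine Metric.cauchySeq_iff.2 fun ε hε => ?_
    -- A midpoint defect below this threshold forces both components of the half-difference below ε
    -- / 4, so the points are within ε / 2.
    have hδ : 0 < min ((ε / 4) ^ q / q) ((ε / 4) ^ 2 / (2 * l)) := by positivity
    obtain ⟨K, hK⟩ := Filter.eventually_atTop.1 (htend.eventually (gt_mem_nhds hδ))
    refine ⟨K, fun i hi j hj => ?_⟩
    have h1 := h.proxFun_midpoint_le u l (x i) (x j)
    have h2 := h.moreau_le u hl (V.smul_mem (1 / 2 : ℝ) (V.add_mem (hxV i) (hxV j)))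
    have h3 : ‖(1 / 2 : ℝ) • ((x i).2 - (x j).2)‖ ^ q / q +
        ‖(1 / 2 : ℝ) • ((x i).1 - (x j).1)‖ ^ 2 / (2 * l) <
        min ((ε / 4) ^ q / q) ((ε / 4) ^ 2 / (2 * l)) := by
      have := hx i
      have := hx j
      have := hK i hi
      have := hK j hj
      linarith
    have h4 : 0 ≤ ‖(1 / 2 : ℝ) • ((x i).2 - (x j).2)‖ ^ q / q := by positivity
    have h5 : 0 ≤ ‖(1 / 2 : ℝ) • ((x i).1 - (x j).1)‖ ^ 2 / (2 * l) := by positivity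
    have h6 : ‖(1 / 2 : ℝ) • ((x i).2 - (x j).2)‖ ^ q / q < (ε / 4) ^ q / q :=
      (by linarith : _ < _).trans_le (min_le_left _ ((ε / 4) ^ 2 / (2 * l)))
    have h7 : ‖(1 / 2 : ℝ) • ((x i).1 - (x j).1)‖ ^ 2 / (2 * l) < (ε / 4) ^ 2 / (2 * l) :=
      (by linarith : _ < _).trans_le (min_le_right ((ε / 4) ^ q / q) _)
    rw [div_lt_div_iff_of_pos_right (by linarith), Real.rpow_lt_rpow_iff (norm_nonneg _)
      (by positivity) (by linarith), norm_smul_of_nonneg (by norm_num)] at h6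
    rw [div_lt_div_iff_of_pos_right (by linarith), pow_lt_pow_iff_left₀ (norm_nonneg _)
      (by positivity) (by norm_num), norm_smul_of_nonneg (by norm_num)] at h7
    rw [dist_eq_norm, Prod.norm_def]
    simp only [Prod.fst_sub, Prod.snd_sub]
    exact max_lt (by linarith) (by linarith)
  obtain ⟨z, hz⟩ := cauchySeq_tendsto_of_complete hcau
  refine ⟨z, h.isClosed.mem_of_tendsto hz (Filter.Eventually.of_forall hxV), fun w hw => ?_⟩
  have hcont : Continuous (proxFun (Y := Y) q u l) := by
    unfold proxFun
    exact ((continuous_snd.norm.rpow_const fun _ => Or.inr (by linarith)).div_const _).add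
      (((continuous_const.sub continuous_fst).norm.pow 2).div_const _)
  refine le_trans ?_ (h.moreau_le u hl hw)
  have h2 : Filter.Tendsto (fun k : ℕ => m + 1 / ((k : ℝ) + 1)) Filter.atTop (𝓝 (m + 0)) :=
    htend.const_add m
  rw [add_zero] at h2
  exact le_of_tendsto_of_tendsto' ((hcont.tendsto z).comp hz) h2 fun k => (hx k).le

/-- Outside the projection of V the energy is infinite and the subgradient inequality is void, so it
can be tested on V alone, as an inequality of real numbers. -/
theorem mem_subgradient_iff (h : IsPowerEnergy q V F) {w f : H} :
    (w, f) ∈ subgradient F ↔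
      ∃ G, (w, G) ∈ V ∧ ∀ z ∈ V, ⟪f, z.1 - w⟫_ℝ + ‖G‖ ^ q / q ≤ ‖z.2‖ ^ q / q := by
  have hq := h.two_le
  have key : ∀ G : Y, ((ENNReal.ofReal (‖G‖ ^ q / q) : ℝ≥0∞) : EReal) =
      ((‖G‖ ^ q / q : ℝ) : EReal) := fun G => by
    rw [EReal.coe_ennreal_ofReal, max_eq_left (by positivity)]
  constructor
  · rintro ⟨h1, h2⟩
    obtain ⟨G, hG⟩ := h.exists_of_lt_top _ h1
    refine ⟨G, hG, fun z hz => ?_⟩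
    have h3 := h2 z.1
    have e1 := h.apply_eq _ hG
    have e2 := h.apply_eq _ hz
    simp only at e1 h3
    rw [e1, e2, key, key] at h3
    exact_mod_cast h3
  · rintro ⟨G, hG, h2⟩
    have e1 := h.apply_eq _ hG
    refine ⟨?_, fun v => ?_⟩
    · simp only [effDomain, mem_ofPred_eq]
      rw [e1]
      exact ENNReal.ofReal_lt_top
    · rcases eq_or_ne (F v) ⊤ with hv | hv
      · simp [hv]
      · obtain ⟨G', hG'⟩ := h.exists_of_lt_top v (lt_top_iff_ne_top.2 hv)
        have e2 := h.apply_eq _ hG'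
        simp only at e1 e2 ⊢
        rw [e1, e2, key, key]
        exact_mod_cast h2 _ hG'

/-- First variation along the segment from the minimizer z to w: convexity handles the q-th power,
the quadratic term contributes the inner product at first order, and the remainder vanishes as t
tends to 0. -/
theorem resolvent_mem_subgradient (h : IsPowerEnergy q V F) {u : H} {l : ℝ} (hl : 0 < l)
    {z : H × Y} (hz : z ∈ V) (hmin : ∀ w ∈ V, proxFun q u l z ≤ proxFun q u l w) :
    (z.1, (1 / l) • (u - z.1)) ∈ subgradient F := by
  have hq := h.two_le
  refine h.mem_subgradient_iff.2 ⟨z.2, hz, fun w hw => ?_⟩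
  have hq0 : 0 < q := by linarith
  have key : ∀ t : ℝ, 0 < t → t < 1 → ⟪(1 / l) • (u - z.1), w.1 - z.1⟫_ℝ + ‖z.2‖ ^ q / q ≤
      ‖w.2‖ ^ q / q + t * (‖w.1 - z.1‖ ^ 2 / (2 * l)) := by
    intro t ht ht1
    have h1 := hmin _ (V.add_mem (V.smul_mem (1 - t) hz) (V.smul_mem t hw))
    simp only [proxFun, Prod.fst_add, Prod.snd_add, Prod.smul_fst, Prod.smul_snd] at h1
    have h2 : ‖(1 - t) • z.2 + t • w.2‖ ^ q ≤ (1 - t) * ‖z.2‖ ^ q + t * ‖w.2‖ ^ q := by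
      have h3 : ‖(1 - t) • z.2 + t • w.2‖ ≤ (1 - t) * ‖z.2‖ + t * ‖w.2‖ := by
        refine (norm_add_le _ _).trans_eq ?_
        rw [norm_smul_of_nonneg (by linarith), norm_smul_of_nonneg ht.le]
      refine (Real.rpow_le_rpow (norm_nonneg _) h3 hq0.le).trans ?_
      have := (convexOn_rpow (by linarith : 1 ≤ q)).2 (norm_nonneg z.2) (norm_nonneg w.2)
        (sub_nonneg.2 ht1.le) ht.le (by ring)
      simpa only [smul_eq_mul] using this
    have h4 : ‖u - ((1 - t) • z.1 + t • w.1)‖ ^ 2 =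
        ‖u - z.1‖ ^ 2 - 2 * t * ⟪u - z.1, w.1 - z.1⟫_ℝ + t ^ 2 * ‖w.1 - z.1‖ ^ 2 := by
      rw [show u - ((1 - t) • z.1 + t • w.1) = (u - z.1) - t • (w.1 - z.1) by module,
        norm_sub_sq_real, inner_smul_right, norm_smul_of_nonneg ht.le]
      ring
    rw [h4] at h1
    rw [real_inner_smul_left]
    have h5 : ‖(1 - t) • z.2 + t • w.2‖ ^ q / q ≤
      ((1 - t) * ‖z.2‖ ^ q + t * ‖w.2‖ ^ q) / q := by gcongr
    have h6 := h1.trans (add_le_add_left h5 _)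
    refine le_of_mul_le_mul_left ?_ ht
    have e : t * (‖w.2‖ ^ q / q + t * (‖w.1 - z.1‖ ^ 2 / (2 * l))) -
        t * (1 / l * ⟪u - z.1, w.1 - z.1⟫_ℝ + ‖z.2‖ ^ q / q) =
        (((1 - t) * ‖z.2‖ ^ q + t * ‖w.2‖ ^ q) / q + (‖u - z.1‖ ^ 2 -
        2 * t * ⟪u - z.1, w.1 - z.1⟫_ℝ + t ^ 2 * ‖w.1 - z.1‖ ^ 2) / (2 * l)) -
        (‖z.2‖ ^ q / q + ‖u - z.1‖ ^ 2 / (2 * l)) := by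
      field_simp
      ring
    linarith
  have htend : Filter.Tendsto (fun t : ℝ => ‖w.2‖ ^ q / q + t * (‖w.1 - z.1‖ ^ 2 / (2 * l)))
      (𝓝[>] 0) (𝓝 (‖w.2‖ ^ q / q + 0 * (‖w.1 - z.1‖ ^ 2 / (2 * l)))) := by
    refine Filter.Tendsto.mono_left ?_ nhdsWithin_le_nhds
    exact ((Filter.tendsto_id).mul_const _).const_add _
  rw [zero_mul, add_zero] at htend
  refine ge_of_tendsto htend ?_
  filter_upwards [Ioo_mem_nhdsGT (zero_lt_one' ℝ)] with t ht
  exact key t ht.1 ht.2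

/-- The `K`-function of the subgradient is controlled by the Moreau envelope. -/
theorem kFun_subgradient_le [CompleteSpace H] [CompleteSpace Y] (h : IsPowerEnergy q V F)
    (u : H) {l : ℝ} (hl : 0 < l) :
    kFun (fun u : H => ‖u‖ₑ) (setNorm (subgradient F)) u l ≤
      ENNReal.ofReal (2 * √(2 * l * moreau q V u l)) := by
  obtain ⟨z, hz, hmin⟩ := h.exists_forall_proxFun_le u hl
  have hq := h.two_le
  have h1 : ‖u - z.1‖ ≤ √(2 * l * moreau q V u l) := by
    refine Real.le_sqrt_of_sq_le ?_
    have h2 : ‖u - z.1‖ ^ 2 / (2 * l) ≤ moreau q V u l := by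
      refine le_trans ?_ (le_moreau hmin)
      have : 0 ≤ ‖z.2‖ ^ q / q := by positivity
      unfold proxFun
      linarith
    rw [div_le_iff₀ (by positivity)] at h2
    linarith
  calc kFun (fun u : H => ‖u‖ₑ) (setNorm (subgradient F)) u l
      ≤ ‖u - z.1‖ₑ + ENNReal.ofReal l * ‖(1 / l) • (u - z.1)‖ₑ := by
        refine (iInf_le _ z.1).trans ?_
        gcongr
        exact setNorm_le (h.resolvent_mem_subgradient hl hz hmin)
    _ = ENNReal.ofReal (2 * ‖u - z.1‖) := by
        rw [← ofReal_norm, ← ofReal_norm, ← ENNReal.ofReal_mul hl.le,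
          ← ENNReal.ofReal_add (norm_nonneg _) (by positivity),
          norm_smul_of_nonneg (by positivity)]
        congr 1
        field_simp
        ring
    _ ≤ _ := by gcongr

/-- Zero belongs to the subgradient at 0, so v = 0 competes at cost ‖u‖. This uniform bound is what
makes large t harmless. -/
theorem kFun_subgradient_le_enorm (h : IsPowerEnergy q V F) (u : H) (l : ℝ) :
    kFun (fun u : H => ‖u‖ₑ) (setNorm (subgradient F)) u l ≤ ‖u‖ₑ := by
  have hq := h.two_le
  have h0 : ((0 : H), (0 : H)) ∈ subgradient F := by
    refine h.mem_subgradient_iff.2 ⟨0, V.zero_mem, fun z _ => ?_⟩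
    rw [inner_zero_left, norm_zero, Real.zero_rpow (by linarith)]
    simp only [zero_div, add_zero]
    positivity
  refine (iInf_le _ 0).trans ?_
  have : setNorm (subgradient F) 0 = 0 := by
    refine le_antisymm ((setNorm_le h0).trans ?_) bot_le
    simp
  simp [this]

/-- The Moreau envelope at a smaller parameter is controlled by the `K`-function. -/
theorem moreau_le_add (h : IsPowerEnergy q V F) (u : H) {l l' B : ℝ} (hl : 0 < l) (hl' : 0 < l')
    (hB : l ≤ B * l') :
    moreau q V u l' ≤ moreau q V u l + (3 + B) / (2 * l) *
      (kFun (fun u : H => ‖u‖ₑ) (setNorm (subgradient F)) u l).toReal ^ 2 := by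
  have hB0 : 0 < B := by
    by_contra hB'
    nlinarith
  set K := kFun (fun u : H => ‖u‖ₑ) (setNorm (subgradient F)) u l
  have hK : K ≠ ⊤ := ne_top_of_le_ne_top enorm_ne_top (h.kFun_subgradient_le_enorm u l)
  -- The infimum K need not be attained: any k above it has an admissible pair (w, f), and k tends
  -- to K at the end.
  have key : ∀ k : ℝ, K.toReal < k →
      moreau q V u l' ≤ moreau q V u l + (3 + B) / (2 * l) * k ^ 2 := by
    intro k hk
    have hk0 : 0 < k := ENNReal.toReal_nonneg.trans_lt hk
    rw [← ENNReal.lt_ofReal_iff_toReal_lt hK] at hk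
    obtain ⟨w, hw⟩ := iInf_lt_iff.1 hk
    have hex : ∃ f, (w, f) ∈ subgradient F ∧
        ‖u - w‖ₑ + ENNReal.ofReal l * ‖f‖ₑ < ENNReal.ofReal k := by
      have : ∃ f : H, ∃ hf : (w, f) ∈ subgradient F,
          ‖u - w‖ₑ + ENNReal.ofReal l * ‖f‖ₑ < ENNReal.ofReal k := by
        by_contra! hcon
        refine hw.not_ge ?_
        simp only [setNorm]
        rw [ENNReal.mul_iInf_of_ne (by simpa using hl) ENNReal.ofReal_ne_top, ENNReal.add_iInf]
        refine le_iInf fun f => ?_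
        rw [ENNReal.mul_iInf_of_ne (by simpa using hl) ENNReal.ofReal_ne_top]
        by_cases hf : (w, f) ∈ subgradient F
        · simpa [hf] using hcon f hf
        · simp [hf]
      obtain ⟨f, hf, hlt⟩ := this
      exact ⟨f, hf, hlt⟩
    obtain ⟨f, hf, hlt⟩ := hex
    rw [← ofReal_norm, ← ofReal_norm, ← ENNReal.ofReal_mul hl.le,
          ← ENNReal.ofReal_add (norm_nonneg _) (by positivity),
          ENNReal.ofReal_lt_ofReal_iff hk0] at hlt
    obtain ⟨G, hG, hsub⟩ := h.mem_subgradient_iff.1 hf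
    have hlf : 0 ≤ l * ‖f‖ := by positivity
    have huw : ‖u - w‖ ≤ k := by linarith
    have hfk : ‖f‖ ≤ k / l := by
      rw [le_div_iff₀ hl]
      linarith [norm_nonneg (u - w)]
    have h1 := h.moreau_le u hl' hG
    -- The inner product costs at most (k / l)(‖u - z‖ + k); completing the square against ‖u - z‖²
    -- / (2l) leaves a loss of 3k² / (2l).
    have h2 : ‖G‖ ^ q / q - 3 / (2 * l) * k ^ 2 ≤ moreau q V u l := by
      refine le_moreau fun z hz => ?_
      have h3 := hsub z hz
      have h4 : -(‖f‖ * ‖z.1 - w‖) ≤ ⟪f, z.1 - w⟫_ℝ :=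
        (abs_le.1 (abs_real_inner_le_norm f (z.1 - w))).1
      have h5 : ‖z.1 - w‖ ≤ ‖u - z.1‖ + k := by
        calc ‖z.1 - w‖ = ‖(u - w) - (u - z.1)‖ := by congr 1; abel
          _ ≤ ‖u - w‖ + ‖u - z.1‖ := norm_sub_le _ _
          _ ≤ _ := by linarith
      have h6 : ‖f‖ * ‖z.1 - w‖ ≤ k / l * (‖u - z.1‖ + k) := by gcongr
      have h7 : k / l * (‖u - z.1‖ + k) ≤ ‖u - z.1‖ ^ 2 / (2 * l) + 3 / (2 * l) * k ^ 2 := by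
        have : 0 ≤ (‖u - z.1‖ - k) ^ 2 / (2 * l) := by positivity
        have e : (‖u - z.1‖ - k) ^ 2 / (2 * l) = ‖u - z.1‖ ^ 2 / (2 * l) + 3 / (2 * l) * k ^ 2 -
          k / l * (‖u - z.1‖ + k) := by
          field_simp
          ring
        linarith
      unfold proxFun
      linarith
    have h8 : ‖u - w‖ ^ 2 / (2 * l') ≤ B / (2 * l) * k ^ 2 := by
      calc ‖u - w‖ ^ 2 / (2 * l') ≤ k ^ 2 / (2 * l') := by gcongr
        _ ≤ B / (2 * l) * k ^ 2 := by
          rw [div_mul_eq_mul_div, div_le_div_iff₀ (by positivity) (by positivity)]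
          nlinarith [sq_nonneg k]
    simp only [proxFun] at h1
    have e : (3 + B) / (2 * l) * k ^ 2 = 3 / (2 * l) * k ^ 2 + B / (2 * l) * k ^ 2 := by ring
    linarith
  have hcont : Continuous fun k : ℝ => moreau q V u l + (3 + B) / (2 * l) * k ^ 2 := by fun_prop
  refine ge_of_tendsto (hcont.tendsto K.toReal |>.mono_left (nhdsWithin_le_nhds (s := Ioi K.toReal)))
    ?_
  filter_upwards [self_mem_nhdsWithin] with k hk
  exact key k hk

end IsPowerEnergy
end PowerEnergy

/-! ### K-functions and the discretization of their weighted norms -/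

section KFunctional

theorem weightedNorm_div_lt_top_iff_summable {θ p B : ℝ} (hθ : 0 < θ) (hp : 0 < p)
    {κ : ℝ → ℝ≥0∞} (hκ : MonotoneOn κ (Ioi 0)) {N : ℝ≥0∞} (hN : N ≠ ⊤)
    (hκN : ∀ t, 0 < t → κ t ≤ N) {l : ℕ → ℝ} (hl : ∀ k, 0 < l k)
    (hl2 : ∀ k, 2 * l (k + 1) ≤ l k) (hlB : ∀ k, l k ≤ B * l (k + 1)) :
    weightedNorm θ p (fun t => κ t / ENNReal.ofReal t) < ⊤ ↔
      Summable fun k => l k ^ (-(θ * p)) * (κ (l k)).toReal ^ p := by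
  have ha : 0 < θ * p := mul_pos hθ hp
  rw [weightedNorm_lt_top_iff hp, setLIntegral_congr_fun measurableSet_Ioi
    fun t ht => ofReal_rpow_mul_div_rpow hp ht (κ t)]
  exact ⟨summable_of_lintegral_lt_top hp hκ hl hl2 ha,
    lintegral_lt_top_of_summable ha hp hκ hN hκN hl hl2 hlB⟩

/-- The sum does not see `τ`: for bounded κ the integral over (0, τ) is finite as soon as the one
over the half-line is, and conversely. -/
theorem weightedNorm_indicator_div_lt_top_iff_summable {θ p B τ : ℝ} (hθ : 0 < θ) (hp : 0 < p)
    (hτ : 0 < τ) {κ : ℝ → ℝ≥0∞} (hκ : MonotoneOn κ (Ioi 0)) {N : ℝ≥0∞} (hN : N ≠ ⊤)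
    (hκN : ∀ t, 0 < t → κ t ≤ N) {l : ℕ → ℝ} (hl : ∀ k, 0 < l k)
    (hl2 : ∀ k, 2 * l (k + 1) ≤ l k) (hlB : ∀ k, l k ≤ B * l (k + 1)) :
    weightedNorm θ p ((Ioo 0 τ).indicator fun t => κ t / ENNReal.ofReal t) < ⊤ ↔
      Summable fun k => l k ^ (-(θ * p)) * (κ (l k)).toReal ^ p := by
  have ha : 0 < θ * p := mul_pos hθ hp
  have hind : (fun t => ENNReal.ofReal (t ^ (p * (1 - θ) - 1)) *
      ((Ioo 0 τ).indicator (fun t => κ t / ENNReal.ofReal t) t) ^ p) =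
      (Ioo 0 τ).indicator fun t => ENNReal.ofReal (t ^ (p * (1 - θ) - 1)) *
        (κ t / ENNReal.ofReal t) ^ p := by
    funext t
    by_cases ht : t ∈ Ioo 0 τ
    · rw [indicator_of_mem ht, indicator_of_mem ht]
    · rw [indicator_of_notMem ht, indicator_of_notMem ht, ENNReal.zero_rpow_of_pos hp, mul_zero]
  rw [weightedNorm_lt_top_iff hp, hind, setLIntegral_indicator measurableSet_Ioo,
    inter_eq_left.2 (show Ioo 0 τ ⊆ Ioi 0 from fun t ht => ht.1),
    setLIntegral_congr_fun measurableSet_Ioo fun t ht => ofReal_rpow_mul_div_rpow hp ht.1 (κ t)]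
  refine ⟨fun h => summable_of_lintegral_lt_top hp hκ hl hl2 ha
    (lintegral_Ioi_lt_top_of_Ioo ha hp hτ hN hκN h), fun h => ?_⟩
  exact (lintegral_mono_set fun t ht => ht.1).trans_lt
    (lintegral_lt_top_of_summable ha hp hκ hN hκN hl hl2 hlB h)

theorem kFun_mono {X : Type*} [AddGroup X] (N₀ N₁ : X → ℝ≥0∞) (x : X) :
    Monotone (kFun N₀ N₁ x) := fun s t hst => by
  unfold kFun
  gcongr

theorem linearK_eq_kFun {X : Type*} [AddGroup X] (N₀ N₁ : X → ℝ≥0∞) :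
    linearK N₀ N₁ = kFun N₀ N₁ := by
  funext x t
  refine le_antisymm (le_iInf fun v => ?_) (le_iInf fun x₀ => le_iInf fun x₁ => le_iInf fun h => ?_)
  · exact (iInf_le _ (x - v)).trans ((iInf_le _ v).trans (iInf_le _ (by simp)))
  · refine (iInf_le _ x₁).trans ?_
    rw [h, add_sub_cancel_right]

end KFunctional

/-! ### Comparison of the nonlinear and the linear interpolation conditions -/

section Comparison

variable {H Y : Type*} [NormedAddCommGroup H] [InnerProductSpace ℝ H]
  [NormedAddCommGroup Y] [NormedSpace ℝ Y]

/-- `W` is equivalent to the norm `u ↦ ‖G‖` on the domain of the linear relation `V ∋ (u, G)`,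
which dominates the norm of `H`, and infinite elsewhere. -/
structure IsGraphNorm (C : ℝ) (V : Submodule ℝ (H × Y)) (W : H → ℝ≥0∞) : Prop where
  pos : 0 < C
  exists_of_lt_top : ∀ u, W u < ⊤ → ∃ G, (u, G) ∈ V
  le_mul : ∀ z ∈ V, W z.1 ≤ ENNReal.ofReal (C * ‖z.2‖)
  le_apply : ∀ z ∈ V, ENNReal.ofReal ‖z.2‖ ≤ W z.1
  norm_le : ∀ z ∈ V, ‖z.1‖ ≤ C * ‖z.2‖

namespace IsGraphNorm

variable {C : ℝ} {V : Submodule ℝ (H × Y)} {W : H → ℝ≥0∞}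

theorem exists_of_kFun_lt (h : IsGraphNorm C V W) {u : H} {s k : ℝ} (hs : 0 < s)
    (hk : kFun (fun u : H => ‖u‖ₑ) W u s < ENNReal.ofReal k) :
    ∃ z ∈ V, ‖u - z.1‖ + s * ‖z.2‖ < k := by
  obtain ⟨w, hw⟩ := iInf_lt_iff.1 hk
  have hwW : W w < ⊤ := by
    by_contra hcon
    rw [not_lt, top_le_iff] at hcon
    rw [hcon, ENNReal.mul_top (by simpa using hs)] at hw
    simp at hw
  obtain ⟨G, hG⟩ := h.exists_of_lt_top w hwW
  refine ⟨(w, G), hG, ?_⟩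
  have h1 : ENNReal.ofReal (‖u - w‖ + s * ‖G‖) < ENNReal.ofReal k := by
    refine lt_of_le_of_lt ?_ hw
    rw [ENNReal.ofReal_add (norm_nonneg _) (by positivity), ENNReal.ofReal_mul hs.le, ofReal_norm]
    gcongr
    exact h.le_apply _ hG
  exact (ENNReal.ofReal_lt_ofReal_iff_of_nonneg (by positivity)).1 h1

theorem kFun_le (h : IsGraphNorm C V W) (u : H) {s : ℝ} (hs : 0 ≤ s) {z : H × Y} (hz : z ∈ V) :
    kFun (fun u : H => ‖u‖ₑ) W u s ≤ ENNReal.ofReal (‖u - z.1‖ + s * (C * ‖z.2‖)) := by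
  have := h.pos
  refine (iInf_le _ z.1).trans ?_
  rw [ENNReal.ofReal_add (norm_nonneg _) (by positivity), ENNReal.ofReal_mul hs, ofReal_norm]
  gcongr
  exact h.le_mul z hz

theorem kFun_le_enorm (h : IsGraphNorm C V W) (u : H) (s : ℝ) :
    kFun (fun u : H => ‖u‖ₑ) W u s ≤ ‖u‖ₑ := by
  refine (iInf_le _ 0).trans ?_
  have : W 0 = 0 := le_antisymm (by simpa using h.le_mul 0 V.zero_mem) bot_le
  simp [this]

theorem kFun_ne_top (h : IsGraphNorm C V W) (u : H) (s : ℝ) :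
    kFun (fun u : H => ‖u‖ₑ) W u s ≠ ⊤ :=
  ne_top_of_le_ne_top enorm_ne_top (h.kFun_le_enorm u s)

/-- If the value were 0, some z ∈ V would satisfy both ‖u - z.1‖ < ‖u‖ / 2 and C ‖z.2‖ < ‖u‖ / 2,
against ‖z.1‖ ≤ C ‖z.2‖. Positivity is needed to form κ ^ (2 - q), whose exponent is nonpositive. -/
theorem kFun_toReal_pos (h : IsGraphNorm C V W) {u : H} (hu : u ≠ 0) {s : ℝ} (hs : 0 < s) :
    0 < (kFun (fun u : H => ‖u‖ₑ) W u s).toReal := by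
  have hC := h.pos
  refine ENNReal.toReal_pos (fun h0 => ?_) (h.kFun_ne_top u s)
  have hpos : 0 < ‖u‖ := norm_pos_iff.2 hu
  have hk : 0 < min (‖u‖ / 2) (s * (‖u‖ / (2 * C))) := by positivity
  obtain ⟨z, hz, hlt⟩ := h.exists_of_kFun_lt hs
    (k := min (‖u‖ / 2) (s * (‖u‖ / (2 * C)))) (by rw [h0]; simpa using hk)
  have h1 := hlt.trans_le (min_le_left _ _)
  have h2 := hlt.trans_le (min_le_right _ _)
  have h3 : ‖z.2‖ < ‖u‖ / (2 * C) := by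
    refine lt_of_mul_lt_mul_left ?_ hs.le
    linarith [norm_nonneg (u - z.1)]
  rw [lt_div_iff₀ (by positivity)] at h3
  have h4 := h.norm_le z hz
  have h5 := norm_le_norm_sub_add u z.1
  nlinarith [norm_nonneg z.2]

theorem kFun_toReal_mono (h : IsGraphNorm C V W) (u : H) {s t : ℝ} (hst : s ≤ t) :
    (kFun (fun u : H => ‖u‖ₑ) W u s).toReal ≤ (kFun (fun u : H => ‖u‖ₑ) W u t).toReal :=
  ENNReal.toReal_mono (h.kFun_ne_top u t) (kFun_mono _ _ _ hst)

theorem kFun_toReal_two_mul_le (h : IsGraphNorm C V W) (u : H) (s : ℝ) :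
    (kFun (fun u : H => ‖u‖ₑ) W u (2 * s)).toReal ≤
      2 * (kFun (fun u : H => ‖u‖ₑ) W u s).toReal := by
  have hle : kFun (fun u : H => ‖u‖ₑ) W u (2 * s) ≤ 2 * kFun (fun u : H => ‖u‖ₑ) W u s := by
    unfold kFun
    rw [ENNReal.mul_iInf_of_ne (by norm_num) (by norm_num)]
    gcongr with v
    rw [mul_add, ENNReal.ofReal_mul (by norm_num), ENNReal.ofReal_ofNat, mul_assoc]
    gcongr
    rw [two_mul]
    exact le_self_add
  have := ENNReal.toReal_mono (ENNReal.mul_ne_top (by norm_num) (h.kFun_ne_top u s)) hle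
  simpa using this

end IsGraphNorm

variable {q C : ℝ} {V : Submodule ℝ (H × Y)} {F W : H → ℝ≥0∞}

/-- A decomposition of linear cost below 2κ is a competitor in the envelope. The choice of l is the
one for which l (κ / s)^q = κ², so both terms of the competitor scale alike. -/
theorem IsPowerEnergy.mul_moreau_le (h : IsPowerEnergy q V F) (hW : IsGraphNorm C V W) {u : H}
    {s κ l : ℝ} (hs : 0 < s) (hκ : κ = (kFun (fun u : H => ‖u‖ₑ) W u s).toReal) (hκ0 : 0 < κ)
    (hl : l = κ ^ (2 - q) * s ^ q) :
    l * moreau q V u l ≤ (2 ^ q / q + 2) * κ ^ 2 := by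
  have hq := h.two_le
  have hl0 : 0 < l := by rw [hl]; positivity
  obtain ⟨z, hz, hlt⟩ := hW.exists_of_kFun_lt (u := u) (k := 2 * κ) hs (by
    rw [ENNReal.lt_ofReal_iff_toReal_lt (hW.kFun_ne_top u s)]
    linarith)
  have h1 := h.moreau_le u hl0 hz
  have hz1 : ‖u - z.1‖ ≤ 2 * κ := by nlinarith [norm_nonneg z.2]
  have hz2 : ‖z.2‖ ≤ 2 * κ / s := by
    rw [le_div_iff₀ hs]
    linarith [norm_nonneg (u - z.1)]
  calc l * moreau q V u l ≤ l * proxFun q u l z := by gcongr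
    _ ≤ l * ((2 * κ / s) ^ q / q + (2 * κ) ^ 2 / (2 * l)) := by
      unfold proxFun
      gcongr
    _ = (2 ^ q / q + 2) * κ ^ 2 := by
      have e : l * (2 * κ / s) ^ q = 2 ^ q * κ ^ 2 := by
        rw [hl, Real.div_rpow (by positivity) hs.le, Real.mul_rpow (by norm_num) hκ0.le,
          Real.rpow_sub hκ0, Real.rpow_two]
        field_simp
      rw [mul_add, ← mul_div_assoc, e]
      field_simp

/-- For every z ∈ V, one of ‖u - z.1‖ and s C ‖z.2‖ is at least κ / 2, and the corresponding term of
the envelope alone suffices. The constant is the sum of those of the two cases. -/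
theorem IsPowerEnergy.sq_le_mul_moreau (h : IsPowerEnergy q V F) (hW : IsGraphNorm C V W) {u : H}
    {s κ l : ℝ} (hs : 0 < s) (hκ : κ = (kFun (fun u : H => ‖u‖ₑ) W u s).toReal) (hκ0 : 0 < κ)
    (hl : l = κ ^ (2 - q) * s ^ q) :
    κ ^ 2 ≤ (8 + (2 * C) ^ q * q) * (l * moreau q V u l) := by
  have hq := h.two_le
  have hC := hW.pos
  have hl0 : 0 < l := by rw [hl]; positivity
  have key : κ ^ 2 / ((8 + (2 * C) ^ q * q) * l) ≤ moreau q V u l := by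
    refine le_moreau fun z hz => ?_
    have h1 : κ ≤ ‖u - z.1‖ + s * (C * ‖z.2‖) := by
      rw [hκ]
      exact ENNReal.toReal_le_of_le_ofReal (by positivity) (hW.kFun_le u hs.le hz)
    rcases le_total (κ / 2) ‖u - z.1‖ with h2 | h2
    · calc κ ^ 2 / ((8 + (2 * C) ^ q * q) * l) ≤ κ ^ 2 / (8 * l) := by
            gcongr
            have : 0 ≤ (2 * C) ^ q * q := by positivity
            linarith
        _ = (κ / 2) ^ 2 / (2 * l) := by field_simp; norm_num
        _ ≤ ‖u - z.1‖ ^ 2 / (2 * l) := by gcongr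
        _ ≤ proxFun q u l z := by
            have : 0 ≤ ‖z.2‖ ^ q / q := by positivity
            unfold proxFun
            linarith
    · have h3 : κ / (2 * C * s) ≤ ‖z.2‖ := by
        rw [div_le_iff₀ (by positivity)]
        linarith
      calc κ ^ 2 / ((8 + (2 * C) ^ q * q) * l) ≤ κ ^ 2 / ((2 * C) ^ q * q * l) := by
            gcongr
            linarith
        _ = (κ / (2 * C * s)) ^ q / q := by
            rw [hl, Real.div_rpow hκ0.le (by positivity), Real.mul_rpow (by positivity) hs.le,
              Real.rpow_sub hκ0, Real.rpow_two]
            field_simp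
        _ ≤ ‖z.2‖ ^ q / q := by gcongr
        _ ≤ proxFun q u l z := by
            have : 0 ≤ ‖u - z.1‖ ^ 2 / (2 * l) := by positivity
            unfold proxFun
            linarith
  rw [div_le_iff₀ (by positivity)] at key
  linarith

/-- For a nonzero element, the interpolation conditions for the subgradient of a power energy and
for the graph norm agree. -/
theorem IsPowerEnergy.interpFun_lt_top_iff_of_ne_zero [CompleteSpace H] [CompleteSpace Y]
    (h : IsPowerEnergy q V F) (hW : IsGraphNorm C V W) {θ p τ : ℝ} (hθ : 0 < θ) (hθ2 : θ < 1 / 2)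
    (hp : 1 < p) (hτ : 0 < τ) {u : H} (hu : u ≠ 0) :
    interpFun (fun u : H => ‖u‖ₑ) (setNorm (subgradient F)) θ p τ u < ⊤ ↔
      weightedNorm (q * θ / (1 + θ * (q - 2))) (p * (1 + θ * (q - 2)))
        (fun t => linearK (fun u : H => ‖u‖ₑ) W u t / ENNReal.ofReal t) < ⊤ := by
  have hq := h.two_le
  have hp0 : 0 < p := by linarith
  have hd : 0 < 1 + θ * (q - 2) := by nlinarith
  set s : ℕ → ℝ := fun k => (1 / 2) ^ k with hs_def
  have hs : ∀ k, 0 < s k := fun k => by positivity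
  have hs1 : ∀ k, s k = 2 * s (k + 1) := fun k => by simp only [hs_def, pow_succ]; ring
  set κ : ℕ → ℝ := fun k => (kFun (fun u : H => ‖u‖ₑ) W u (s k)).toReal with hκ_def
  have hκ : ∀ k, 0 < κ k := fun k => hW.kFun_toReal_pos hu (hs k)
  have hκ1 : ∀ k, κ (k + 1) ≤ κ k := fun k =>
    hW.kFun_toReal_mono u (by linarith [hs1 k, hs (k + 1)])
  have hκ2 : ∀ k, κ k ≤ 2 * κ (k + 1) := fun k => by
    have := hW.kFun_toReal_two_mul_le u (s (k + 1))
    rwa [← hs1 k] at this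
  -- The sampling points of the nonlinear side depend on u. They are lacunary with bounded ratios
  -- because κ is monotone with κ k ≤ 2 κ (k+1) and 2 - q ≤ 0; the factor 4 below is 2^(2-q) · 2^q.
  set l : ℕ → ℝ := fun k => κ k ^ (2 - q) * s k ^ q with hl_def
  have hl : ∀ k, 0 < l k := fun k => by
    have := hκ k
    have := hs k
    positivity
  have hl4 : ∀ k, 4 * l (k + 1) ≤ l k := fun k => by
    have h1 := hs (k + 1)
    have h2 := hκ (k + 1)
    have h3 := hκ k
    simp only [hl_def, hs1 k]
    calc 4 * (κ (k + 1) ^ (2 - q) * s (k + 1) ^ q)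
        = (2 * κ (k + 1)) ^ (2 - q) * (2 * s (k + 1)) ^ q := by
          rw [Real.mul_rpow (by norm_num) h2.le, Real.mul_rpow (by norm_num) h1.le,
            Real.rpow_sub zero_lt_two, Real.rpow_two]
          field_simp
          norm_num
      _ ≤ κ k ^ (2 - q) * (2 * s (k + 1)) ^ q := by
          gcongr ?_ * _
          exact Real.rpow_le_rpow_of_nonpos h3 (hκ2 k) (by linarith)
  have hlB : ∀ k, l k ≤ 2 ^ q * l (k + 1) := fun k => by
    have h1 := hs (k + 1)
    have h2 := hκ (k + 1)
    have h3 := hκ k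
    simp only [hl_def, hs1 k]
    calc κ k ^ (2 - q) * (2 * s (k + 1)) ^ q ≤ κ (k + 1) ^ (2 - q) * (2 * s (k + 1)) ^ q := by
          gcongr ?_ * _
          exact Real.rpow_le_rpow_of_nonpos h2 (hκ1 k) (by linarith)
      _ = 2 ^ q * (κ (k + 1) ^ (2 - q) * s (k + 1) ^ q) := by
          rw [Real.mul_rpow (by norm_num) h1.le]
          ring
  have hl2 : ∀ k, 2 * l (k + 1) ≤ l k := fun k => by linarith [hl4 k, hl (k + 1)]
  set K : ℕ → ℝ := fun k =>
    (kFun (fun u : H => ‖u‖ₑ) (setNorm (subgradient F)) u (l k)).toReal with hK_def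
  have hK0 : ∀ k, 0 ≤ K k := fun k => ENNReal.toReal_nonneg
  set m : ℕ → ℝ := fun k => moreau q V u (l k) with hm_def
  have hm0 : ∀ k, 0 ≤ m k := fun k => h.moreau_nonneg u (hl k)
  have hup : ∀ k, l k * m k ≤ (2 ^ q / q + 2) * κ k ^ 2 := fun k =>
    h.mul_moreau_le hW (hs k) rfl (hκ k) rfl
  have hlow : ∀ k, κ k ^ 2 ≤ (8 + (2 * C) ^ q * q) * (l k * m k) := fun k =>
    h.sq_le_mul_moreau hW (hs k) rfl (hκ k) rfl
  rw [interpFun, weightedNorm_indicator_div_lt_top_iff_summable hθ hp0 hτ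
      ((kFun_mono _ _ u).monotoneOn _) enorm_ne_top (fun t _ => h.kFun_subgradient_le_enorm u t)
      hl hl2 hlB, linearK_eq_kFun, weightedNorm_div_lt_top_iff_summable (by positivity)
      (by positivity) ((kFun_mono _ _ u).monotoneOn _) enorm_ne_top
      (fun t _ => hW.kFun_le_enorm u t) hs (fun k => (hs1 k).ge) (fun k => (hs1 k).le)]
  -- This identity dictates the exponents α and r.
  have heq : ∀ k, s k ^ (-(q * θ / (1 + θ * (q - 2)) * (p * (1 + θ * (q - 2))))) *
      κ k ^ (p * (1 + θ * (q - 2))) = (l k ^ (-θ) * κ k) ^ p := fun k => by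
    have h1 := hs k
    have h2 := hκ k
    simp only [hl_def]
    rw [Real.mul_rpow (by positivity) h2.le, Real.mul_rpow (by positivity) (by positivity),
      Real.mul_rpow (by positivity) (by positivity), ← Real.rpow_mul h2.le, ← Real.rpow_mul h2.le,
      ← Real.rpow_mul h1.le, ← Real.rpow_mul h1.le, mul_right_comm, ← Real.rpow_add h2, mul_comm]
    congr 2
    · ring
    · field_simp
  have heq' : ∀ k, l k ^ (-(θ * p)) * K k ^ p = (l k ^ (-θ) * K k) ^ p := fun k => by
    have h1 := hl k
    rw [Real.mul_rpow (by positivity) (hK0 k), ← Real.rpow_mul h1.le, neg_mul]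
  change Summable (fun k => l k ^ (-(θ * p)) * K k ^ p) ↔ Summable (fun k =>
    s k ^ (-(q * θ / (1 + θ * (q - 2)) * (p * (1 + θ * (q - 2))))) *
      κ k ^ (p * (1 + θ * (q - 2))))
  simp only [heq, heq']
  constructor
  · intro hsum
    set D : ℝ := (3 + 2 ^ q) / 2 with hD
    have hD0 : 0 < D := by positivity
    -- Square root of the growth bound for the envelope, multiplied by l (k+1)^(1/2-θ) ≤ (l k /
    -- 4)^(1/2-θ). The contraction factor is below 1 because θ < 1/2.
    have hrec : ∀ k, l (k + 1) ^ (1 / 2 - θ) * √(m (k + 1)) ≤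
        (1 / 4) ^ (1 / 2 - θ) * (l k ^ (1 / 2 - θ) * √(m k) + √D * (l k ^ (-θ) * K k)) := by
      intro k
      have hk := hl k
      have hk1 := hl (k + 1)
      have h1 : m (k + 1) ≤ m k + (3 + 2 ^ q) / (2 * l k) * K k ^ 2 :=
        h.moreau_le_add u hk hk1 (hlB k)
      have h2 : √(m (k + 1)) ≤ √(m k) + √D * K k * l k ^ (-(1 / 2) : ℝ) := by
        have e : (l k ^ (-(1 / 2) : ℝ)) ^ 2 = 1 / l k := by
          rw [← Real.rpow_natCast, ← Real.rpow_mul hk.le]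
          norm_num [Real.rpow_neg_one]
        have h3 : 0 ≤ √D * K k * l k ^ (-(1 / 2) : ℝ) := by
          have := hK0 k
          positivity
        refine Real.sqrt_le_iff.2 ⟨by positivity, h1.trans ?_⟩
        rw [add_sq, Real.sq_sqrt (hm0 k), mul_pow, mul_pow, Real.sq_sqrt hD0.le, e]
        have h4 : 0 ≤ 2 * √(m k) * (√D * K k * l k ^ (-(1 / 2) : ℝ)) := by positivity
        have e2 : (3 + 2 ^ q) / (2 * l k) * K k ^ 2 = D * K k ^ 2 * (1 / l k) := by
          rw [hD]
          field_simp
        linarith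
      calc l (k + 1) ^ (1 / 2 - θ) * √(m (k + 1))
          ≤ (1 / 4 * l k) ^ (1 / 2 - θ) * (√(m k) + √D * K k * l k ^ (-(1 / 2) : ℝ)) := by
            gcongr
            linarith [hl4 k]
        _ = (1 / 4) ^ (1 / 2 - θ) * (l k ^ (1 / 2 - θ) * √(m k) + √D *
              ((l k ^ (1 / 2 - θ) * l k ^ (-(1 / 2) : ℝ)) * K k)) := by
            rw [Real.mul_rpow (by norm_num) hk.le]
            ring
        _ = _ := by
            rw [← Real.rpow_add hk]
            ring_nf
    have hc := summable_rpow_of_le_mul_add (ρ := (1 / 4) ^ (1 / 2 - θ))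
      (c := fun k => l k ^ (1 / 2 - θ) * √(m k)) hp.le (by positivity)
      (Real.rpow_lt_one (by norm_num) (by norm_num) (by linarith)) (Real.sqrt_nonneg D)
      (fun k => by have := hl k; positivity)
      (fun k => by have := hl k; have := hK0 k; positivity) hrec hsum
    refine Summable.of_nonneg_of_le (fun k => ?_) (fun k => ?_)
      (hc.mul_left (√(8 + (2 * C) ^ q * q) ^ p))
    · have := hl k
      have := hκ k
      positivity
    · have hk := hl k
      have hκk := hκ k
      rw [← Real.mul_rpow (by positivity) (by positivity)]
      refine Real.rpow_le_rpow (by positivity) ?_ hp0.le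
      have h1 : κ k ≤ √(8 + (2 * C) ^ q * q) * (l k ^ (1 / 2 : ℝ) * √(m k)) := by
        rw [← Real.sqrt_eq_rpow, ← Real.sqrt_mul hk.le, ← Real.sqrt_mul (by
          have := hW.pos
          positivity)]
        exact Real.le_sqrt_of_sq_le (hlow k)
      calc l k ^ (-θ) * κ k
          ≤ l k ^ (-θ) * (√(8 + (2 * C) ^ q * q) * (l k ^ (1 / 2 : ℝ) * √(m k))) := by gcongr
        _ = √(8 + (2 * C) ^ q * q) * ((l k ^ (1 / 2 : ℝ) * l k ^ (-θ)) * √(m k)) := by ring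
        _ = _ := by rw [← Real.rpow_add hk, ← sub_eq_add_neg]
  · intro hsum
    refine Summable.of_nonneg_of_le (fun k => ?_) (fun k => ?_)
      (hsum.mul_left ((2 * √(2 * (2 ^ q / q + 2))) ^ p))
    · have := hl k
      have := hK0 k
      positivity
    · have hk := hl k
      have hκk := hκ k
      have hKk := hK0 k
      rw [← Real.mul_rpow (by positivity) (by positivity)]
      refine Real.rpow_le_rpow (by positivity) ?_ hp0.le
      -- This direction is a termwise comparison and needs no summation argument.
      have h1 : K k ≤ 2 * √(2 * (2 ^ q / q + 2)) * κ k := by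
        calc K k ≤ 2 * √(2 * l k * m k) :=
              ENNReal.toReal_le_of_le_ofReal (by positivity) (h.kFun_subgradient_le u hk)
          _ ≤ 2 * √(2 * (2 ^ q / q + 2) * κ k ^ 2) := by
              gcongr 2 * √?_
              linarith [hup k]
          _ = _ := by
              rw [Real.sqrt_mul (by positivity), Real.sqrt_sq hκk.le]
              ring
      calc l k ^ (-θ) * K k ≤ l k ^ (-θ) * (2 * √(2 * (2 ^ q / q + 2)) * κ k) := by gcongr
        _ = _ := by ring

theorem weightedNorm_zero {θ p : ℝ} : weightedNorm θ p (fun _ => 0) = 0 := by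
  simp [weightedNorm]

/-- The interpolation space of a Hilbert space and the subgradient of a power energy is a
classical real interpolation space. -/
theorem IsPowerEnergy.effDomain_interpFun_eq_realInterp [CompleteSpace H] [CompleteSpace Y]
    (h : IsPowerEnergy q V F) (hW : IsGraphNorm C V W) {θ p τ : ℝ} (hθ : 0 < θ) (hθ2 : θ < 1 / 2)
    (hp : 1 < p) (hτ : 0 < τ) :
    effDomain (interpFun (fun u : H => ‖u‖ₑ) (setNorm (subgradient F)) θ p τ) =
      realInterp (fun u : H => ‖u‖ₑ) W (q * θ / (1 + θ * (q - 2))) (p * (1 + θ * (q - 2))) := by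
  ext u
  rcases eq_or_ne u 0 with rfl | hu
  · have h1 : ∀ t, kFun (fun u : H => ‖u‖ₑ) (setNorm (subgradient F)) 0 t = 0 := fun t =>
      le_antisymm (by simpa using h.kFun_subgradient_le_enorm 0 t) bot_le
    have h2 : ∀ t, kFun (fun u : H => ‖u‖ₑ) W 0 t = 0 := fun t =>
      le_antisymm (by simpa using hW.kFun_le_enorm 0 t) bot_le
    simp only [effDomain, realInterp, mem_ofPred_eq, interpFun, linearK_eq_kFun, h1, h2,
      ENNReal.zero_div, indicator_zero, weightedNorm_zero]
  · exact h.interpFun_lt_top_iff_of_ne_zero hW hθ hθ2 hp hτ hu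

end Comparison

/-! ### Test functions and distributional gradients -/

section TestFunctions

variable {n : ℕ} {Ω : Set (EuclideanSpace ℝ (Fin n))} {φ ψ : EuclideanSpace ℝ (Fin n) → ℝ}

theorem gradient_eq_zero_of_notMem_tsupport {x : EuclideanSpace ℝ (Fin n)} (hx : x ∉ tsupport φ) :
    gradient φ x = 0 := by
  rw [gradient, fderiv_of_notMem_tsupport ℝ hx, map_zero]

namespace IsTestFunction

theorem zero : IsTestFunction Ω (0 : EuclideanSpace ℝ (Fin n) → ℝ) :=
  ⟨contDiff_const, HasCompactSupport.zero, by simp [tsupport]⟩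

theorem add (hφ : IsTestFunction Ω φ) (hψ : IsTestFunction Ω ψ) : IsTestFunction Ω (φ + ψ) :=
  ⟨hφ.contDiff.add hψ.contDiff, hφ.hasCompactSupport.add hψ.hasCompactSupport,
    (tsupport_add φ ψ).trans (union_subset hφ.tsupport_subset hψ.tsupport_subset)⟩

theorem const_smul (hφ : IsTestFunction Ω φ) (c : ℝ) : IsTestFunction Ω (c • φ) :=
  ⟨hφ.contDiff.const_smul c, hφ.hasCompactSupport.smul_left (f := fun _ => c),
    (tsupport_smul_subset_right (fun _ => c) φ).trans hφ.tsupport_subset⟩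

theorem differentiable (hφ : IsTestFunction Ω φ) : Differentiable ℝ φ :=
  hφ.contDiff.differentiable (by simp)

theorem eq_zero_of_notMem (hφ : IsTestFunction Ω φ) {x : EuclideanSpace ℝ (Fin n)} (hx : x ∉ Ω) :
    φ x = 0 :=
  image_eq_zero_of_notMem_tsupport fun h => hx (hφ.tsupport_subset h)

theorem gradient_eq_zero_of_notMem (hφ : IsTestFunction Ω φ) {x : EuclideanSpace ℝ (Fin n)}
    (hx : x ∉ Ω) : gradient φ x = 0 :=
  gradient_eq_zero_of_notMem_tsupport fun h => hx (hφ.tsupport_subset h)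

theorem continuous_gradient (hφ : IsTestFunction Ω φ) : Continuous (gradient φ) :=
  (LinearIsometryEquiv.continuous _).comp (hφ.contDiff.continuous_fderiv (by simp))

theorem hasCompactSupport_gradient (hφ : IsTestFunction Ω φ) : HasCompactSupport (gradient φ) :=
  HasCompactSupport.intro hφ.hasCompactSupport fun _ hx => gradient_eq_zero_of_notMem_tsupport hx

theorem memLp (hφ : IsTestFunction Ω φ) (p : ℝ≥0∞)
    (μ : Measure (EuclideanSpace ℝ (Fin n))) [IsFiniteMeasureOnCompacts μ] : MemLp φ p μ :=
  hφ.contDiff.continuous.memLp_of_hasCompactSupport hφ.hasCompactSupport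

theorem memLp_gradient (hφ : IsTestFunction Ω φ) (p : ℝ≥0∞)
    (μ : Measure (EuclideanSpace ℝ (Fin n))) [IsFiniteMeasureOnCompacts μ] :
    MemLp (gradient φ) p μ :=
  hφ.continuous_gradient.memLp_of_hasCompactSupport hφ.hasCompactSupport_gradient

/-- The classical gradient of a test function is its distributional gradient. -/
theorem hasWeakGradient (hφ : IsTestFunction Ω φ) : HasWeakGradient Ω φ (gradient φ) := by
  refine ⟨(hφ.contDiff.continuous.locallyIntegrable).locallyIntegrableOn _,
    hφ.continuous_gradient.locallyIntegrable.locallyIntegrableOn _, fun ψ hψ => ?_⟩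
  rw [setIntegral_eq_integral_of_forall_compl_eq_zero fun x hx => by
      rw [hφ.eq_zero_of_notMem hx, zero_smul],
    setIntegral_eq_integral_of_forall_compl_eq_zero fun x hx => by
      rw [hψ.eq_zero_of_notMem hx, zero_smul]]
  have hint : ∀ {f g : EuclideanSpace ℝ (Fin n) → ℝ}, IsTestFunction Ω f → IsTestFunction Ω g →
      Integrable (fun x => f x • gradient g x) := fun hf hg =>
    (hf.contDiff.continuous.smul hg.continuous_gradient).integrable_of_hasCompactSupport
      (hg.hasCompactSupport_gradient.smul_left (f := _))
  have key : ∀ {f g : EuclideanSpace ℝ (Fin n) → ℝ}, IsTestFunction Ω f → IsTestFunction Ω g →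
      ∀ v, ⟪v, ∫ x, f x • gradient g x⟫_ℝ = ∫ x, f x * fderiv ℝ g x v := fun hf hg v => by
    rw [← integral_inner (hint hf hg)]
    refine integral_congr_ae (Filter.Eventually.of_forall fun x => ?_)
    simp only [real_inner_comm _ v, real_inner_smul_left, inner_gradient_left]
  have hint' : ∀ {f g : EuclideanSpace ℝ (Fin n) → ℝ}, IsTestFunction Ω f → IsTestFunction Ω g →
      ∀ v, Integrable (fun x => f x * fderiv ℝ g x v) := fun hf hg v => by
    refine ((hint hf hg).const_inner v).congr (Filter.Eventually.of_forall fun x => ?_)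
    simp only [real_inner_comm _ v, real_inner_smul_left, inner_gradient_left]
  -- Pairing with a fixed vector reduces the identity to scalar integration by parts for directional
  -- derivatives.
  refine ext_inner_left ℝ fun v => ?_
  rw [inner_neg_right, key hφ hψ, key hψ hφ,
    integral_mul_fderiv_eq_neg_fderiv_mul_of_integrable]
  · simp only [mul_comm]
  · simpa only [mul_comm] using hint' hψ hφ v
  · exact hint' hφ hψ v
  · exact (hφ.contDiff.continuous.mul hψ.contDiff.continuous).integrable_of_hasCompactSupport
      (hψ.hasCompactSupport.mul_left)
  · exact fun x _ => hφ.differentiable x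
  · exact fun x _ => hψ.differentiable x

end IsTestFunction

namespace HasWeakGradient

variable {u v : EuclideanSpace ℝ (Fin n) → ℝ}
  {g h : EuclideanSpace ℝ (Fin n) → EuclideanSpace ℝ (Fin n)}

theorem congr (hg : HasWeakGradient Ω u g) (huv : u =ᵐ[volume.restrict Ω] v)
    (hgh : g =ᵐ[volume.restrict Ω] h) : HasWeakGradient Ω v h := by
  refine ⟨hg.locallyIntegrableOn_fun.congr huv, hg.locallyIntegrableOn_grad.congr hgh,
    fun φ hφ => ?_⟩
  have e1 : ∫ x in Ω, v x • gradient φ x = ∫ x in Ω, u x • gradient φ x :=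
    integral_congr_ae (huv.mono fun x hx => by simp only [hx])
  have e2 : ∫ x in Ω, φ x • h x = ∫ x in Ω, φ x • g x :=
    integral_congr_ae (hgh.mono fun x hx => by simp only [hx])
  rw [e1, e2, hg.integral_eq φ hφ]

theorem integrable_smul (hg : HasWeakGradient Ω u g) (hφ : IsTestFunction Ω φ) :
    Integrable (fun x => φ x • g x) := by
  have h1 := (hg.locallyIntegrableOn_grad.integrableOn_compact_subset hφ.tsupport_subset
    hφ.hasCompactSupport).continuousOn_smul hφ.contDiff.continuous.continuousOn
    hφ.hasCompactSupport
  refine (integrableOn_iff_integrable_of_support_subset ?_).1 h1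
  exact (Function.support_smul_subset_left _ _).trans (subset_tsupport φ)

/-- The fundamental lemma of the calculus of variations; it makes the choice in `weakGradient`
harmless. -/
theorem ae_eq (hΩ : IsOpen Ω) (hg : HasWeakGradient Ω u g) (hh : HasWeakGradient Ω u h) :
    g =ᵐ[volume.restrict Ω] h := by
  have h1 := hΩ.ae_eq_zero_of_integral_contDiff_smul_eq_zero
    (f := fun x => g x - h x) (μ := volume)
    (hg.locallyIntegrableOn_grad.sub hh.locallyIntegrableOn_grad) fun φ h1 h2 h3 => by
      have hφ : IsTestFunction Ω φ := ⟨h1, h2, h3⟩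
      have e1 := hg.integral_eq φ hφ
      have e2 := hh.integral_eq φ hφ
      rw [setIntegral_eq_integral_of_forall_compl_eq_zero (f := fun x => φ x • g x) fun x hx => by
        rw [hφ.eq_zero_of_notMem hx, zero_smul]] at e1
      rw [setIntegral_eq_integral_of_forall_compl_eq_zero (f := fun x => φ x • h x) fun x hx => by
        rw [hφ.eq_zero_of_notMem hx, zero_smul]] at e2
      simp only [smul_sub]
      rw [integral_sub (hg.integrable_smul hφ) (hh.integrable_smul hφ), sub_eq_zero]
      exact neg_injective (e1.symm.trans e2)
  refine (ae_restrict_iff' hΩ.measurableSet).2 (h1.mono fun x hx hxΩ => ?_)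
  exact sub_eq_zero.1 (hx hxΩ)

end HasWeakGradient

end TestFunctions

/-! ### The graph of the gradient in L² × L^r and its closed subgraph -/

section GradientSpace

variable {n : ℕ} (Ω : Set (EuclideanSpace ℝ (Fin n))) (r : ℝ≥0∞) [hr : Fact (1 ≤ r)]

/-- The space `L^r(Ω)ⁿ`. -/
abbrev LpVec : Type := Lp (EuclideanSpace ℝ (Fin n)) r (volume.restrict Ω)

variable {Ω r}

theorem hasWeakGradient_iff_integral_eq [IsFiniteMeasure (volume.restrict Ω)]
    (z : L2 Ω × LpVec Ω r) :
    HasWeakGradient Ω z.1 z.2 ↔ ∀ φ, IsTestFunction Ω φ →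
      ∫ x in Ω, z.1 x • gradient φ x = -∫ x in Ω, φ x • z.2 x := by
  refine ⟨fun h => h.integral_eq, fun h => ⟨?_, ?_, h⟩⟩
  · exact IntegrableOn.locallyIntegrableOn ((Lp.memLp z.1).integrable (by norm_num))
  · exact IntegrableOn.locallyIntegrableOn ((Lp.memLp z.2).integrable hr.out)

/-- The defining relation of the distributional gradient is a continuous linear equation. -/
theorem exists_clm_eq_integral [IsFiniteMeasure (volume.restrict Ω)]
    {φ : EuclideanSpace ℝ (Fin n) → ℝ} (hφ : IsTestFunction Ω φ) :
    ∃ T : (L2 Ω × LpVec Ω r) →L[ℝ] EuclideanSpace ℝ (Fin n), ∀ z,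
      T z = (∫ x in Ω, z.1 x • gradient φ x) + ∫ x in Ω, φ x • z.2 x := by
  have : Fact (1 ≤ r.conjExponent) := ⟨by simp [ENNReal.conjExponent]⟩
  let B := ContinuousLinearMap.lsmul ℝ ℝ (E := EuclideanSpace ℝ (Fin n))
  -- Test functions and their gradients lie in every Lebesgue space, so both integrals are Hölder
  -- pairings with a fixed element.
  let w := (hφ.memLp_gradient 2 (volume.restrict Ω)).toLp
  let w' := (hφ.memLp r.conjExponent (volume.restrict Ω)).toLp
  refine ⟨((B.lpPairing (volume.restrict Ω) 2 2).flip w).comp (ContinuousLinearMap.fst ℝ _ _) +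
    ((B.flip.lpPairing (volume.restrict Ω) r r.conjExponent).flip w').comp
      (ContinuousLinearMap.snd ℝ _ _), fun z => ?_⟩
  simp only [add_apply, ContinuousLinearMap.comp_apply,
    ContinuousLinearMap.flip_apply, ContinuousLinearMap.coe_fst', ContinuousLinearMap.coe_snd',
    ContinuousLinearMap.lpPairing_eq_integral]
  congr 1
  · refine integral_congr_ae ?_
    filter_upwards [(hφ.memLp_gradient 2 (volume.restrict Ω)).coeFn_toLp] with x hx
    simp [B, w, hx]
  · refine integral_congr_ae ?_
    filter_upwards [(hφ.memLp r.conjExponent (volume.restrict Ω)).coeFn_toLp] with x hx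
    simp [B, w', hx]

variable (Ω r)

/-- The graph of the distributional gradient on `L²(Ω)` with values in `L^r(Ω)ⁿ`. -/
noncomputable def gradSpace [IsFiniteMeasure (volume.restrict Ω)] :
    Submodule ℝ (L2 Ω × LpVec Ω r) where
  carrier := {z | HasWeakGradient Ω z.1 z.2}
  add_mem' {a b} ha hb := by
    simp only [mem_ofPred_eq, hasWeakGradient_iff_integral_eq, eq_neg_iff_add_eq_zero] at ha hb ⊢
    intro φ hφ
    obtain ⟨T, hT⟩ := exists_clm_eq_integral (r := r) hφ
    rw [← hT, map_add, hT, hT, ha φ hφ, hb φ hφ, add_zero]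
  zero_mem' := by
    simp only [mem_ofPred_eq, hasWeakGradient_iff_integral_eq, eq_neg_iff_add_eq_zero]
    intro φ hφ
    obtain ⟨T, hT⟩ := exists_clm_eq_integral (r := r) hφ
    rw [← hT, map_zero]
  smul_mem' c a ha := by
    simp only [mem_ofPred_eq, hasWeakGradient_iff_integral_eq, eq_neg_iff_add_eq_zero] at ha ⊢
    intro φ hφ
    obtain ⟨T, hT⟩ := exists_clm_eq_integral (r := r) hφ
    rw [← hT, map_smul, hT, ha φ hφ, smul_zero]

/-- The graph of the gradient on test functions. -/
noncomputable def testGraph [IsFiniteMeasure (volume.restrict Ω)] :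
    Submodule ℝ (L2 Ω × LpVec Ω r) where
  carrier := {z | z ∈ gradSpace Ω r ∧ ∃ φ, IsTestFunction Ω φ ∧ z.1 =ᵐ[volume.restrict Ω] φ}
  add_mem' {a b} ha hb := by
    obtain ⟨ha, φ, hφ, haφ⟩ := ha
    obtain ⟨hb, ψ, hψ, hbψ⟩ := hb
    exact ⟨Submodule.add_mem _ ha hb, φ + ψ, hφ.add hψ,
      (Lp.coeFn_add a.1 b.1).trans (haφ.add hbψ)⟩
  zero_mem' := ⟨Submodule.zero_mem _, 0, IsTestFunction.zero, Lp.coeFn_zero _ _ _⟩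
  smul_mem' c a ha := by
    obtain ⟨ha, φ, hφ, haφ⟩ := ha
    exact ⟨Submodule.smul_mem _ c ha, c • φ, hφ.const_smul c,
      (Lp.coeFn_smul c a.1).trans (haφ.const_smul c)⟩

/-- The closure of the graph of the gradient on test functions. -/
noncomputable def zeroGraph [IsFiniteMeasure (volume.restrict Ω)] :
    Submodule ℝ (L2 Ω × LpVec Ω r) :=
  (testGraph Ω r).topologicalClosure

variable {Ω r}

theorem mem_gradSpace_iff [IsFiniteMeasure (volume.restrict Ω)] {z : L2 Ω × LpVec Ω r} :
    z ∈ gradSpace Ω r ↔ HasWeakGradient Ω z.1 z.2 := Iff.rfl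

theorem isClosed_gradSpace [IsFiniteMeasure (volume.restrict Ω)] :
    IsClosed (gradSpace Ω r : Set (L2 Ω × LpVec Ω r)) := by
  have : (gradSpace Ω r : Set (L2 Ω × LpVec Ω r)) = ⋂ (φ) (_ : IsTestFunction Ω φ),
      {z | (∫ x in Ω, z.1 x • gradient φ x) + ∫ x in Ω, φ x • z.2 x = 0} := by
    ext z
    simp only [SetLike.mem_coe, mem_gradSpace_iff, hasWeakGradient_iff_integral_eq, mem_iInter,
      mem_ofPred_eq, eq_neg_iff_add_eq_zero]
  rw [this]
  refine isClosed_biInter fun φ hφ => ?_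
  obtain ⟨T, hT⟩ := exists_clm_eq_integral (r := r) hφ
  simp only [← hT]
  exact isClosed_eq T.continuous continuous_const

theorem zeroGraph_le_gradSpace [IsFiniteMeasure (volume.restrict Ω)] :
    zeroGraph Ω r ≤ gradSpace Ω r :=
  Submodule.topologicalClosure_minimal _ (fun _ hz => hz.1) isClosed_gradSpace

theorem testGraph_le_zeroGraph [IsFiniteMeasure (volume.restrict Ω)] :
    testGraph Ω r ≤ zeroGraph Ω r := Submodule.le_topologicalClosure _

theorem exists_mem_testGraph [IsFiniteMeasure (volume.restrict Ω)] {v : L2 Ω}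
    (hv : ∃ φ, IsTestFunction Ω φ ∧ v =ᵐ[volume.restrict Ω] φ) :
    ∃ G, (v, G) ∈ testGraph Ω r := by
  obtain ⟨φ, hφ, hvφ⟩ := hv
  have hm := hφ.memLp_gradient r (volume.restrict Ω)
  exact ⟨hm.toLp, hφ.hasWeakGradient.congr hvφ.symm hm.coeFn_toLp.symm, φ, hφ, hvφ⟩

theorem sobolevNorm_eq [IsFiniteMeasure (volume.restrict Ω)] (hΩ : IsOpen Ω) {s q : ℝ}
    [Fact (1 ≤ ENNReal.ofReal q)] {z : L2 Ω × LpVec Ω (ENNReal.ofReal q)}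
    (hz : z ∈ gradSpace Ω (ENNReal.ofReal q)) :
    weakGradient Ω z.1 =ᵐ[volume.restrict Ω] z.2 ∧ sobolevNorm Ω s q z.1 =
      eLpNorm z.1 (ENNReal.ofReal s) (volume.restrict Ω) + ‖z.2‖ₑ := by
  have hex : ∃ g, HasWeakGradient Ω z.1 g := ⟨_, hz⟩
  have h1 : weakGradient Ω z.1 =ᵐ[volume.restrict Ω] z.2 := by
    rw [weakGradient, dif_pos hex]
    exact hex.choose_spec.ae_eq hΩ hz
  refine ⟨h1, ?_⟩
  rw [sobolevNorm, if_pos hex, eLpNorm_congr_ae h1, Lp.enorm_def]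

theorem exists_mem_gradSpace_of_sobolevNorm_lt_top [IsFiniteMeasure (volume.restrict Ω)]
    {s q : ℝ} [Fact (1 ≤ ENNReal.ofReal q)] {u : L2 Ω} (hu : sobolevNorm Ω s q u < ⊤) :
    ∃ G, (u, G) ∈ gradSpace Ω (ENNReal.ofReal q) := by
  by_cases hex : ∃ g, HasWeakGradient Ω u g
  · rw [sobolevNorm, if_pos hex, ENNReal.add_lt_top] at hu
    have h1 : HasWeakGradient Ω u (weakGradient Ω u) := by
      rw [weakGradient, dif_pos hex]
      exact hex.choose_spec
    have hm : MemLp (weakGradient Ω u) (ENNReal.ofReal q) (volume.restrict Ω) :=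
      ⟨h1.locallyIntegrableOn_grad.aestronglyMeasurable, hu.2⟩
    exact ⟨hm.toLp, h1.congr (Filter.EventuallyEq.refl _ _) hm.coeFn_toLp.symm⟩
  · rw [sobolevNorm, if_neg hex] at hu
    exact absurd hu (lt_irrefl _)

end GradientSpace

/-! ### Poincaré's inequality for test functions -/

section Poincare

variable {n : ℕ} {Ω : Set (EuclideanSpace ℝ (Fin n))} {φ : EuclideanSpace ℝ (Fin n) → ℝ}

theorem norm_gradient (x : EuclideanSpace ℝ (Fin n)) : ‖gradient φ x‖ = ‖fderiv ℝ φ x‖ :=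
  LinearIsometryEquiv.norm_map _ _

/-- Poincaré's inequality, in the form obtained by integrating by parts against a coordinate. -/
theorem IsTestFunction.integral_norm_rpow_le (hφ : IsTestFunction Ω φ) (hn : 1 ≤ n) {q R : ℝ}
    (hq : 1 < q) (hR : ∀ x ∈ Ω, ‖x‖ ≤ R) :
    ∫ x, ‖φ x‖ ^ q ≤ q * R * ∫ x, ‖φ x‖ ^ (q - 1) * ‖gradient φ x‖ := by
  let i : Fin n := ⟨0, hn⟩
  let e : EuclideanSpace ℝ (Fin n) := EuclideanSpace.single i 1
  let f : EuclideanSpace ℝ (Fin n) → ℝ := fun x => ‖φ x‖ ^ q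
  let g : EuclideanSpace ℝ (Fin n) → ℝ := fun x => x i
  let P : EuclideanSpace ℝ (Fin n) →L[ℝ] ℝ := EuclideanSpace.proj i
  have hq0 : 0 < q := by linarith
  have hg : ∀ x, HasFDerivAt g P x := fun x => P.hasFDerivAt
  have hge : ∀ x, fderiv ℝ g x e = 1 := fun x => by
    rw [(hg x).fderiv]
    simp [P, e]
  have hf1 : ContDiff ℝ 1 f := (hφ.contDiff.of_le (by simp)).norm_rpow hq
  have hsupp : ∀ x, x ∉ tsupport φ → f x = 0 := fun x hx => by
    simp only [f, image_eq_zero_of_notMem_tsupport hx, norm_zero, Real.zero_rpow hq0.ne']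
  have hfc : HasCompactSupport f := HasCompactSupport.intro hφ.hasCompactSupport hsupp
  have hfd : ∀ x, fderiv ℝ f x e = q * ‖φ x‖ ^ (q - 2) * φ x * fderiv ℝ φ x e := fun x => by
    have h1 := (hasDerivAt_norm_rpow (φ x) hq).comp_hasFDerivAt x
      (hφ.differentiable x).hasFDerivAt
    rw [show f = (fun y : ℝ => ‖y‖ ^ q) ∘ φ from rfl, h1.fderiv]
    simp
  have hgcont : Continuous g := P.continuous
  have hi1 : Integrable fun x => fderiv ℝ f x e * g x :=
    (((hf1.continuous_fderiv (by simp)).clm_apply continuous_const).mul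
      hgcont).integrable_of_hasCompactSupport
      (HasCompactSupport.mul_right (hfc.fderiv_apply ℝ e))
  have hfi : Integrable f := hf1.continuous.integrable_of_hasCompactSupport hfc
  have hi2 : Integrable fun x => f x * fderiv ℝ g x e := by
    simpa only [hge, mul_one] using hfi
  have hi3 : Integrable fun x => f x * g x :=
    (hf1.continuous.mul hgcont).integrable_of_hasCompactSupport hfc.mul_right
  have hparts := integral_mul_fderiv_eq_neg_fderiv_mul_of_integrable hi1 hi2 hi3
    (fun x _ => hf1.differentiable (by simp) x) (fun x _ => (hg x).differentiableAt)
  simp only [hge, mul_one] at hparts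
  change ∫ x, f x ≤ _
  rw [hparts, ← integral_neg, ← integral_const_mul]
  have hi4 : Integrable fun x => q * R * (‖φ x‖ ^ (q - 1) * ‖gradient φ x‖) := by
    refine Integrable.const_mul ?_ _
    refine Continuous.integrable_of_hasCompactSupport ?_ ?_
    · exact (hφ.contDiff.continuous.norm.rpow_const fun _ => Or.inr (by linarith)).mul
        hφ.continuous_gradient.norm
    · exact hφ.hasCompactSupport_gradient.norm.mul_left
  refine integral_mono hi1.neg hi4 fun x => ?_
  by_cases hx : x ∈ Ω
  · simp only [hfd]
    refine (neg_le_abs _).trans ?_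
    have h1 : |fderiv ℝ φ x e| ≤ ‖gradient φ x‖ := by
      rw [norm_gradient, ← Real.norm_eq_abs]
      refine ((fderiv ℝ φ x).le_opNorm e).trans_eq ?_
      simp [e]
    have h2 : |g x| ≤ R := (PiLp.norm_apply_le x i).trans (hR x hx)
    have h3 : ‖φ x‖ ^ (q - 2) * |φ x| = ‖φ x‖ ^ (q - 1) := by
      rcases eq_or_ne (φ x) 0 with h0 | h0
      · simp [h0, Real.zero_rpow (by linarith : q - 1 ≠ 0)]
      · rw [← Real.norm_eq_abs, ← Real.rpow_add_one (norm_ne_zero_iff.2 h0)]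
        ring_nf
    rw [abs_mul, abs_mul, abs_mul, abs_mul, abs_of_pos hq0,
      abs_of_nonneg (Real.rpow_nonneg (norm_nonneg _) _), mul_assoc q, h3]
    calc q * ‖φ x‖ ^ (q - 1) * |fderiv ℝ φ x e| * |g x|
        ≤ q * ‖φ x‖ ^ (q - 1) * ‖gradient φ x‖ * R := by gcongr
      _ = _ := by ring
  · simp only [hfd, hφ.eq_zero_of_notMem hx, hφ.gradient_eq_zero_of_notMem hx]
    simp

/-- Hölder's inequality turns the integrated form into A ≤ q R A^(1/q') D^(1/q), with q' the
conjugate exponent; for A > 0 one divides by A^(1/q'). -/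
theorem IsTestFunction.eLpNorm_le (hφ : IsTestFunction Ω φ) (hn : 1 ≤ n) {q R : ℝ}
    (hq : 1 < q) (hR0 : 0 ≤ R) (hR : ∀ x ∈ Ω, ‖x‖ ≤ R) :
    eLpNorm φ (ENNReal.ofReal q) (volume.restrict Ω) ≤
      ENNReal.ofReal (q * R) * eLpNorm (gradient φ) (ENNReal.ofReal q) (volume.restrict Ω) := by
  have hq0 : 0 < q := by linarith
  have hne : ENNReal.ofReal q ≠ 0 := by simpa using hq0
  have e1 : eLpNorm φ (ENNReal.ofReal q) (volume.restrict Ω) =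
      eLpNorm φ (ENNReal.ofReal q) volume :=
    eLpNorm_restrict_eq_of_support_subset fun x hx => by
      by_contra h
      exact hx (hφ.eq_zero_of_notMem h)
  have e2 : eLpNorm (gradient φ) (ENNReal.ofReal q) (volume.restrict Ω) =
      eLpNorm (gradient φ) (ENNReal.ofReal q) volume :=
    eLpNorm_restrict_eq_of_support_subset fun x hx => by
      by_contra h
      exact hx (hφ.gradient_eq_zero_of_notMem h)
  have hm1 := hφ.memLp (ENNReal.ofReal q) volume
  have hm2 := hφ.memLp_gradient (ENNReal.ofReal q) volume
  rw [e1, e2, hm1.eLpNorm_eq_integral_rpow_norm hne ENNReal.ofReal_ne_top,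
    hm2.eLpNorm_eq_integral_rpow_norm hne ENNReal.ofReal_ne_top,
    ← ENNReal.ofReal_mul (by positivity), ENNReal.toReal_ofReal hq0.le]
  refine ENNReal.ofReal_le_ofReal ?_
  set A := ∫ x, ‖φ x‖ ^ q
  set D := ∫ x, ‖gradient φ x‖ ^ q
  have hA0 : 0 ≤ A := integral_nonneg fun x => by positivity
  have hD0 : 0 ≤ D := integral_nonneg fun x => by positivity
  rcases hA0.eq_or_lt with hA | hA
  · rw [← hA, Real.zero_rpow (inv_ne_zero hq0.ne')]
    positivity
  have hconj := Real.HolderConjugate.conjExponent hq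
  have hc1 : (q - 1) * q.conjExponent = q := hconj.sub_one_mul_conj
  have hc0 : 0 < q.conjExponent := hconj.symm.pos
  have hholder := integral_mul_norm_le_Lp_mul_Lq (μ := volume) hconj.symm
    (f := fun x => ‖φ x‖ ^ (q - 1)) (g := fun x => ‖gradient φ x‖)
    (Continuous.memLp_of_hasCompactSupport
      (hφ.contDiff.continuous.norm.rpow_const fun _ => Or.inr (by linarith))
      (HasCompactSupport.intro hφ.hasCompactSupport fun x hx => by
        rw [image_eq_zero_of_notMem_tsupport hx, norm_zero, Real.zero_rpow (by linarith)])) hm2.norm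
  have hn1 : ∀ x, ‖‖φ x‖ ^ (q - 1)‖ = ‖φ x‖ ^ (q - 1) := fun x =>
    Real.norm_of_nonneg (by positivity)
  simp only [norm_norm, hn1, ← Real.rpow_mul (norm_nonneg _), hc1] at hholder
  have h1 := hφ.integral_norm_rpow_le hn hq hR
  have h2 : A ≤ q * R * (A ^ (1 / q.conjExponent) * D ^ (1 / q)) :=
    h1.trans (by gcongr)
  have h3 : A = A ^ (1 / q.conjExponent) * A ^ q⁻¹ := by
    rw [← Real.rpow_add hA, one_div, hconj.symm.inv_add_inv_eq_one, Real.rpow_one]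
  have h4 : 0 < A ^ (1 / q.conjExponent) := by positivity
  refine le_of_mul_le_mul_left ?_ h4
  rw [← h3]
  refine h2.trans_eq ?_
  rw [one_div q]
  ring

end Poincare

/-! ### Clarkson's inequality -/

section Clarkson

/-- The parallelogram law for squares, combined with superadditivity and convexity of x ↦ x^(q/2),
where q / 2 ≥ 1. -/
theorem norm_half_add_rpow_add_le {E : Type*} [NormedAddCommGroup E] [InnerProductSpace ℝ E]
    {q : ℝ} (hq : 2 ≤ q) (a b : E) :
    ‖(1 / 2 : ℝ) • (a + b)‖ ^ q + ‖(1 / 2 : ℝ) • (a - b)‖ ^ q ≤ (‖a‖ ^ q + ‖b‖ ^ q) / 2 := by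
  have key : ∀ x : ℝ, 0 ≤ x → x ^ q = (x ^ 2) ^ (q / 2) := fun x hx => by
    rw [← Real.rpow_natCast, ← Real.rpow_mul hx]
    congr 1
    push_cast
    ring
  have hq2 : 1 ≤ q / 2 := by linarith
  rw [key _ (norm_nonneg _), key _ (norm_nonneg _), key _ (norm_nonneg a), key _ (norm_nonneg b)]
  refine (Real.add_rpow_le_rpow_add (by positivity) (by positivity) hq2).trans ?_
  have h1 := parallelogram_law_with_norm ℝ a b
  have h2 : ‖(1 / 2 : ℝ) • (a + b)‖ ^ 2 + ‖(1 / 2 : ℝ) • (a - b)‖ ^ 2 =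
      (1 / 2) * ‖a‖ ^ 2 + (1 / 2) * ‖b‖ ^ 2 := by
    rw [norm_smul_of_nonneg (by norm_num), norm_smul_of_nonneg (by norm_num)]
    linarith
  rw [h2]
  have h3 := (convexOn_rpow hq2).2 (sq_nonneg ‖a‖) (sq_nonneg ‖b‖)
    (by norm_num : (0 : ℝ) ≤ 1 / 2) (by norm_num : (0 : ℝ) ≤ 1 / 2) (by norm_num)
  simp only [smul_eq_mul] at h3
  linarith

theorem Lp_norm_rpow_eq_integral {α E : Type*} [MeasurableSpace α] {μ : Measure α}
    [NormedAddCommGroup E] {q : ℝ} (hq : 0 < q) (f : Lp E (ENNReal.ofReal q) μ) :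
    ‖f‖ ^ q = ∫ x, ‖f x‖ ^ q ∂μ := by
  have hne : ENNReal.ofReal q ≠ 0 := by simpa using hq
  have h0 : 0 ≤ ∫ x, ‖f x‖ ^ q ∂μ := integral_nonneg fun x => by positivity
  rw [Lp.norm_def, (Lp.memLp f).eLpNorm_eq_integral_rpow_norm hne ENNReal.ofReal_ne_top,
    ENNReal.toReal_ofReal hq.le, ENNReal.toReal_ofReal (by positivity), ← Real.rpow_mul h0,
    inv_mul_cancel₀ hq.ne', Real.rpow_one]

/-- Clarkson's inequality in `L^q`, for `q ≥ 2`. -/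
theorem Lp_clarkson {α E : Type*} [MeasurableSpace α] {μ : Measure α}
    [NormedAddCommGroup E] [InnerProductSpace ℝ E] {q : ℝ} (hq : 2 ≤ q)
    (f g : Lp E (ENNReal.ofReal q) μ) :
    ‖(1 / 2 : ℝ) • (f + g)‖ ^ q + ‖(1 / 2 : ℝ) • (f - g)‖ ^ q ≤ (‖f‖ ^ q + ‖g‖ ^ q) / 2 := by
  have hq0 : 0 < q := by linarith
  have hne : ENNReal.ofReal q ≠ 0 := by simpa using hq0
  have hint : ∀ f : Lp E (ENNReal.ofReal q) μ, Integrable (fun x => ‖f x‖ ^ q) μ := fun f => by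
    simpa [ENNReal.toReal_ofReal hq0.le] using
      (Lp.memLp f).integrable_norm_rpow hne ENNReal.ofReal_ne_top
  simp only [Lp_norm_rpow_eq_integral hq0]
  rw [← integral_add (hint _) (hint _), ← integral_add (hint _) (hint _), ← integral_div]
  refine integral_mono_ae ((hint _).add (hint _)) (((hint _).add (hint _)).div_const _) ?_
  filter_upwards [Lp.coeFn_smul (1 / 2 : ℝ) (f + g), Lp.coeFn_smul (1 / 2 : ℝ) (f - g),
    Lp.coeFn_add f g, Lp.coeFn_sub f g] with x h1 h2 h3 h4
  simp only [h1, h2, Pi.smul_apply, h3, h4, Pi.add_apply, Pi.sub_apply]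
  exact norm_half_add_rpow_add_le hq _ _

end Clarkson

theorem enorm_fst_le {E F : Type*} [NormedAddCommGroup E] [NormedAddCommGroup F] (z : E × F) :
    ‖z.1‖ₑ ≤ ‖z‖ₑ := by
  rw [← ofReal_norm, ← ofReal_norm]
  exact ENNReal.ofReal_le_ofReal (norm_fst_le z)

theorem enorm_snd_le {E F : Type*} [NormedAddCommGroup E] [NormedAddCommGroup F] (z : E × F) :
    ‖z.2‖ₑ ≤ ‖z‖ₑ := by
  rw [← ofReal_norm, ← ofReal_norm]
  exact ENNReal.ofReal_le_ofReal (norm_snd_le z)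

/-! ### Sobolev closures of the test functions as projections of the closed graph -/

section SobolevZero

variable {n : ℕ} {Ω : Set (EuclideanSpace ℝ (Fin n))} [IsFiniteMeasure (volume.restrict Ω)]
  {q : ℝ} [Fact (1 ≤ ENNReal.ofReal q)]

/-- The L^s norm need not be continuous for L² convergence, but by Fatou it is lower semicontinuous
along an almost everywhere convergent subsequence. -/
theorem eLpNorm_le_of_mem_zeroGraph {C : ℝ≥0∞} (hC : C ≠ ⊤) {s : ℝ≥0∞}
    (h : ∀ z ∈ testGraph Ω (ENNReal.ofReal q),
      eLpNorm z.1 s (volume.restrict Ω) ≤ C * ‖z.2‖ₑ) {z : L2 Ω × LpVec Ω (ENNReal.ofReal q)}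
    (hz : z ∈ zeroGraph Ω (ENNReal.ofReal q)) :
    eLpNorm z.1 s (volume.restrict Ω) ≤ C * ‖z.2‖ₑ := by
  obtain ⟨x, hx, hxz⟩ := mem_closure_iff_seq_limit.1
    (show z ∈ closure (testGraph Ω (ENNReal.ofReal q) : Set _) from hz)
  have h1 : Filter.Tendsto (fun k => (x k).1) Filter.atTop (𝓝 z.1) :=
    (continuous_fst.tendsto z).comp hxz
  obtain ⟨ns, hns, hae⟩ := (tendstoInMeasure_of_tendsto_Lp h1).exists_seq_tendsto_ae
  have h2 : Filter.Tendsto (fun k => C * ‖(x (ns k)).2‖ₑ) Filter.atTop (𝓝 (C * ‖z.2‖ₑ)) := by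
    refine ENNReal.Tendsto.const_mul ?_ (Or.inr hC)
    exact ((continuous_enorm.comp continuous_snd).tendsto z).comp
      (hxz.comp hns.tendsto_atTop)
  rw [← h2.liminf_eq]
  refine (Lp.eLpNorm_lim_le_liminf_eLpNorm (fun k => Lp.aestronglyMeasurable _) _ hae).trans ?_
  exact Filter.liminf_le_liminf (Filter.Eventually.of_forall fun k => h _ (hx _))

theorem eLpNorm_le_of_mem_testGraph (hΩ : IsOpen Ω) (hn : 1 ≤ n) {R : ℝ}
    (hq : 1 < q) (hR0 : 0 ≤ R) (hR : ∀ x ∈ Ω, ‖x‖ ≤ R)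
    {z : L2 Ω × LpVec Ω (ENNReal.ofReal q)} (hz : z ∈ testGraph Ω (ENNReal.ofReal q)) :
    eLpNorm z.1 (ENNReal.ofReal q) (volume.restrict Ω) ≤ ENNReal.ofReal (q * R) * ‖z.2‖ₑ := by
  obtain ⟨hz1, φ, hφ, hzφ⟩ := hz
  have h1 : z.2 =ᵐ[volume.restrict Ω] gradient φ :=
    (mem_gradSpace_iff.1 hz1).ae_eq hΩ
      (hφ.hasWeakGradient.congr hzφ.symm (Filter.EventuallyEq.refl _ _))
  rw [Lp.enorm_def, eLpNorm_congr_ae hzφ, eLpNorm_congr_ae h1]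
  exact hφ.eLpNorm_le hn hq hR0 hR

/-- The closure of the test functions with respect to a Sobolev norm consists of the first
components of the closed graph `zeroGraph`. -/
theorem mem_sobolevZero_iff (hΩ : IsOpen Ω) {s : ℝ} {C D : ℝ≥0∞} (hC : C ≠ ⊤) (hD : D ≠ ⊤)
    (hCs : ∀ v : L2 Ω, ‖v‖ₑ ≤ D * eLpNorm v (ENNReal.ofReal s) (volume.restrict Ω))
    (hs : ∀ z ∈ zeroGraph Ω (ENNReal.ofReal q),
      eLpNorm z.1 (ENNReal.ofReal s) (volume.restrict Ω) ≤ C * ‖z‖ₑ) {u : L2 Ω} :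
    u ∈ sobolevZero Ω s q ↔ ∃ G, (u, G) ∈ zeroGraph Ω (ENNReal.ofReal q) := by
  -- One choice of δ serves both inclusions: the Sobolev norm and the norm of L² × L^q bound each
  -- other, with constant D one way and C the other.
  have hsmall : ∀ {K ε : ℝ≥0∞}, K ≠ ⊤ → 0 < ε → ∃ δ, 0 < δ ∧ ∀ x, x < δ → K * x + x < ε := by
    intro K ε hK hε
    refine ⟨ε / (K + 1), ENNReal.div_pos hε.ne' (by simp [hK]), fun x hx => ?_⟩
    have h0 : K + 1 ≠ 0 := by simp
    have h1 : K + 1 ≠ ⊤ := by simp [hK]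
    rw [ENNReal.lt_div_iff_mul_lt (Or.inl h0) (Or.inl h1)] at hx
    calc K * x + x = x * (K + 1) := by ring
      _ < ε := hx
  constructor
  · rintro ⟨hu, happ⟩
    obtain ⟨G, hG⟩ := exists_mem_gradSpace_of_sobolevNorm_lt_top hu
    refine ⟨G, ?_⟩
    change (u, G) ∈ closure (testGraph Ω (ENNReal.ofReal q) : Set _)
    rw [EMetric.mem_closure_iff]
    intro ε hε
    obtain ⟨δ, hδ, hδε⟩ := hsmall hD hε
    obtain ⟨v, hv, hlt⟩ := happ δ hδ
    obtain ⟨G', hG'⟩ := exists_mem_testGraph (r := ENNReal.ofReal q) hv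
    refine ⟨(v, G'), hG', ?_⟩
    have hmem : (u - v, G - G') ∈ gradSpace Ω (ENNReal.ofReal q) := Submodule.sub_mem _ hG hG'.1
    replace hlt := (sobolevNorm_eq (s := s) hΩ hmem).2.symm.trans_lt hlt
    have h3 := hδε _ hlt
    rw [Prod.edist_eq, edist_eq_enorm_sub, edist_eq_enorm_sub]
    refine max_lt (lt_of_le_of_lt ?_ h3) (lt_of_le_of_lt ?_ h3)
    · refine (hCs _).trans (le_add_right ?_)
      gcongr
      exact le_self_add
    · exact le_add_left le_add_self
  · rintro ⟨G, hG⟩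
    refine ⟨?_, fun ε hε => ?_⟩
    · rw [(sobolevNorm_eq (s := s) hΩ (zeroGraph_le_gradSpace hG)).2]
      exact ENNReal.add_lt_top.2 ⟨(hs _ hG).trans_lt
        (ENNReal.mul_lt_top hC.lt_top enorm_lt_top), enorm_lt_top⟩
    · obtain ⟨δ, hδ, hδε⟩ := hsmall hC hε
      obtain ⟨⟨v, G'⟩, hv, hlt⟩ := EMetric.mem_closure_iff.1
        (show (u, G) ∈ closure (testGraph Ω (ENNReal.ofReal q) : Set _) from hG) δ hδ
      refine ⟨v, hv.2, ?_⟩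
      have hmem : (u - v, G - G') ∈ zeroGraph Ω (ENNReal.ofReal q) :=
        Submodule.sub_mem _ hG (testGraph_le_zeroGraph hv)
      rw [edist_eq_enorm_sub] at hlt
      refine (sobolevNorm_eq (s := s) hΩ (zeroGraph_le_gradSpace hmem)).2.trans_lt ?_
      refine lt_of_le_of_lt ?_ (hδε _ hlt)
      exact add_le_add (hs _ hmem) (enorm_snd_le (_, G - G'))

theorem energy_eq (hΩ : IsOpen Ω) (hq : 0 < q) {z : L2 Ω × LpVec Ω (ENNReal.ofReal q)}
    (hz : z ∈ gradSpace Ω (ENNReal.ofReal q)) (hV : z.1 ∈ V0 Ω q) :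
    energy Ω q z.1 = ENNReal.ofReal (‖z.2‖ ^ q / q) := by
  have hne : ENNReal.ofReal q ≠ 0 := by simpa using hq
  have h1 := (sobolevNorm_eq (s := 2) hΩ hz).1
  have h2 : ∫⁻ x in Ω, ‖weakGradient Ω z.1 x‖ₑ ^ q = ∫⁻ x in Ω, ‖z.2 x‖ₑ ^ q :=
    lintegral_congr_ae (h1.mono fun x hx => by simp only [hx])
  have h3 : ∫⁻ x in Ω, ‖z.2 x‖ₑ ^ q = ‖z.2‖ₑ ^ q := by
    rw [Lp.enorm_def, eLpNorm_eq_lintegral_rpow_enorm_toReal hne ENNReal.ofReal_ne_top,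
      ENNReal.toReal_ofReal hq.le, ← ENNReal.rpow_mul, one_div, inv_mul_cancel₀ hq.ne',
      ENNReal.rpow_one]
  rw [energy, if_pos hV, h2, h3, ← ofReal_norm, ENNReal.ofReal_rpow_of_nonneg (norm_nonneg _) hq.le,
    ← ENNReal.ofReal_mul (by positivity)]
  congr 1
  ring

end SobolevZero
end QLap

/-! ### The Dirichlet q-Laplace operator -/

theorem mainTheorem11 {n : ℕ} (hn : 1 ≤ n) (Ω : Set (EuclideanSpace ℝ (Fin n)))
    (hΩ : QLap.IsBoundedSmoothDomain Ω) (q θ p τ : ℝ) (hq : 2 ≤ q)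
    (hθ : θ ∈ Set.Ioo (0 : ℝ) (1 / 2)) (hp : 1 < p) (hτ : 0 < τ) :
    QLap.effDomain
        (QLap.interpFun (fun u : QLap.L2 Ω => ‖u‖ₑ) (QLap.setNorm (QLap.negLaplacian Ω q)) θ p τ) =
      QLap.realInterp (fun u : QLap.L2 Ω => ‖u‖ₑ) (QLap.W0norm Ω q)
        (q * θ / (1 + θ * (q - 2))) (p * (1 + θ * (q - 2))) := by
  open QLap in
  have hfin : IsFiniteMeasure (volume.restrict Ω) :=
    ⟨by simpa using hΩ.isBounded.measure_lt_top⟩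
  have hq0 : 0 < q := by linarith
  have hfact : Fact (1 ≤ ENNReal.ofReal q) := ⟨by
    rw [← ENNReal.ofReal_one]
    exact ENNReal.ofReal_le_ofReal (by linarith)⟩
  obtain ⟨R, hR0, hR⟩ := hΩ.isBounded.exists_pos_norm_le
  set V := zeroGraph Ω (ENNReal.ofReal q)
  set P : ℝ≥0∞ := ENNReal.ofReal (q * R)
  have hpoinc : ∀ z ∈ V, eLpNorm z.1 (ENNReal.ofReal q) (volume.restrict Ω) ≤ P * ‖z.2‖ₑ :=
    fun z hz => eLpNorm_le_of_mem_zeroGraph ENNReal.ofReal_ne_top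
      (fun z hz => eLpNorm_le_of_mem_testGraph hΩ.isOpen hn (by linarith) hR0.le hR hz) hz
  have h2 : ENNReal.ofReal 2 = 2 := ENNReal.ofReal_ofNat 2
  -- D is the constant of the embedding of L^q into L² on a set of finite measure.
  obtain ⟨D, hD, hDle⟩ : ∃ D : ℝ≥0∞, D ≠ ⊤ ∧ ∀ v : L2 Ω,
      ‖v‖ₑ ≤ D * eLpNorm v (ENNReal.ofReal q) (volume.restrict Ω) := by
    refine ⟨volume.restrict Ω univ ^ (1 / (2 : ℝ≥0∞).toReal - 1 / (ENNReal.ofReal q).toReal),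
      ?_, fun v => ?_⟩
    · refine ENNReal.rpow_ne_top_of_nonneg ?_ (measure_ne_top _ _)
      rw [ENNReal.toReal_ofReal hq0.le, ENNReal.toReal_ofNat, sub_nonneg]
      exact one_div_le_one_div_of_le (by norm_num) hq
    · rw [Lp.enorm_def, mul_comm]
      refine eLpNorm_le_eLpNorm_mul_rpow_measure_univ ?_ (Lp.aestronglyMeasurable v)
      rw [← h2]
      exact ENNReal.ofReal_le_ofReal hq
  have hV0 : ∀ u, u ∈ V0 Ω q ↔ ∃ G, (u, G) ∈ V := fun u =>
    mem_sobolevZero_iff hΩ.isOpen (C := 1) (D := 1) (by simp) (by simp)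
      (fun v => by rw [one_mul, Lp.enorm_def, h2])
      (fun z _ => by rw [one_mul, h2, ← Lp.enorm_def]; exact enorm_fst_le z)
  have hW0 : ∀ u, u ∈ W0 Ω q ↔ ∃ G, (u, G) ∈ V := fun u =>
    mem_sobolevZero_iff hΩ.isOpen (C := P) (D := D) ENNReal.ofReal_ne_top hD hDle
      (fun z hz => (hpoinc z hz).trans (by gcongr; exact enorm_snd_le z))
  have hF : IsPowerEnergy q V (energy Ω q) :=
    { two_le := hq
      isClosed := Submodule.isClosed_topologicalClosure _
      clarkson := Lp_clarkson hq
      apply_eq := fun z hz => energy_eq hΩ.isOpen hq0 (zeroGraph_le_gradSpace hz)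
        ((hV0 z.1).2 ⟨z.2, hz⟩)
      exists_of_lt_top := fun u hu => by
        by_contra h
        rw [energy, if_neg fun h' => h ((hV0 u).1 h')] at hu
        exact lt_irrefl _ hu }
  have hW0norm : ∀ z ∈ V, W0norm Ω q z.1 =
      eLpNorm z.1 (ENNReal.ofReal q) (volume.restrict Ω) + ‖z.2‖ₑ := fun z hz => by
    rw [W0norm, if_pos ((hW0 z.1).2 ⟨z.2, hz⟩),
      (sobolevNorm_eq hΩ.isOpen (zeroGraph_le_gradSpace hz)).2]
  -- One constant for two bounds: q R + 1 for the W^{1,q} norm in terms of the gradient, and D q R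
  -- for the L² norm.
  have hC : 0 < q * R + 1 + D.toReal * (q * R) := by positivity
  have hW : IsGraphNorm (q * R + 1 + D.toReal * (q * R)) V (W0norm Ω q) :=
    { pos := hC
      exists_of_lt_top := fun u hu => by
        by_contra h
        rw [W0norm, if_neg fun h' => h ((hW0 u).1 h')] at hu
        exact lt_irrefl _ hu
      le_mul := fun z hz => by
        rw [hW0norm z hz]
        calc eLpNorm z.1 (ENNReal.ofReal q) (volume.restrict Ω) + ‖z.2‖ₑ
            ≤ P * ‖z.2‖ₑ + ‖z.2‖ₑ := by gcongr; exact hpoinc z hz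
          _ = ENNReal.ofReal ((q * R + 1) * ‖z.2‖) := by
              rw [← ofReal_norm, ← ENNReal.ofReal_mul (by positivity),
                ← ENNReal.ofReal_add (by positivity) (by positivity)]
              congr 1
              ring
          _ ≤ _ := by
              have : 0 ≤ D.toReal * (q * R) := by positivity
              exact ENNReal.ofReal_le_ofReal
                (mul_le_mul_of_nonneg_right (by linarith) (norm_nonneg _))
      le_apply := fun z hz => by
        rw [hW0norm z hz, ofReal_norm]
        exact le_add_self
      norm_le := fun z hz => by
        have h1 : ‖z.1‖ₑ ≤ D * (P * ‖z.2‖ₑ) := (hDle z.1).trans (by gcongr; exact hpoinc z hz)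
        have h3 := ENNReal.toReal_mono
          (ENNReal.mul_ne_top hD (ENNReal.mul_ne_top ENNReal.ofReal_ne_top enorm_ne_top)) h1
        rw [ENNReal.toReal_mul, ENNReal.toReal_mul, ENNReal.toReal_ofReal (by positivity),
          toReal_enorm, toReal_enorm] at h3
        have : 0 ≤ (q * R + 1) * ‖z.2‖ := by positivity
        linarith }
  exact hF.effDomain_interpFun_eq_realInterp hW hθ.1 hθ.2 hp hτ
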